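/- **Problem.** An instance consists of a finite directed graph $G=(\mathcal V,\mathcal E)$ on $N\ge 1$ social nodes with weights $w_j>0$ and integer thresholds $\theta_j\ge 1$, a finite set $\mathcal W$ of $M$ physical nodes, each $l\in\mathcal W$ covering a non-empty set $\mathcal Q_l\subseteq\mathcal V$ with $\bigcup_l\mathcal Q_l=\mathcal V$, and budgets $0\le K_s\le N$, $0\le K_p\le M$. Choose a set $S\subseteq\mathcal V$ of at most $K_s$ seed nodes and a set $H\subseteq\mathcal W$ of at most $K_p$ open physical nodes. A social node can be active only if some open physical node covers it. At time $0$ exactly the seed nodes covered by an open physical node are active; active nodes stay active; an inactive node $j$ covered by an open physical node becomes active at time $t+1$ if at least $\theta_j$ of its incoming neighbours are active at time $t$. The value of $(S,H)$ is the total weight of the nodes active at time $N$ (no changes occur afterwards), and $(S,H)$ is optimal if it has maximal value among all pairs that respect the budgets. **Assumptions.** $\theta_j=1$ for all $j$; $M=N$ and $|\mathcal Q_l|=1$ for all $l$, so that every social node $v$ has exactly one corresponding physical node $\bar v$; and $G$ is a forest of out-trees, i.e. a disjoint union of directed rooted trees with all edges pointing away from the root. **Algorithm.** *Attaching a list.*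 To attach a list $L$ of $x\ge2$ nodes below a node $j$: if $x=2$, construct edges from $j$ to both nodes of $L$; if $x>2$, construct an edge from $j$ to an arbitrary $m\in L$, construct a new dummy node $d$ and an edge from $j$ to $d$, and attach the $x-1$ nodes of $L\setminus\{m\}$ below $d$. Dummy nodes have weight $0$, have no physical node and are never seeds. 1. While some node $i$ has more than two outgoing neighbours, select such an $i$ arbitrarily, delete its outgoing edges and attach its former outgoing neighbours below $i$. 2. If the resulting forest has a single tree, let $r$ be its root; otherwise construct a dummy node $r$ and attach the roots of all its trees below $r$. This yields an out-tree $G'$ with root $r$ in which every node has at most two outgoing neighbours. 3. For every node $v$ of $G'$, computing the leaves first and then, in an arbitrary order, nodes whose outgoing neighbours have all been computed, and for all $0\le k\le K_s$, $0\le l\le K_p$, compute the following values. Together with each value store a set of seeds and a set of open physical nodes that belong to it: sums of values go with unions of sets, and a maximum takes the sets of the chosen alternative, with any maximizer $(k_j,l_j)$ allowed. Below, $\sum_u$ runs over the (one or two) outgoing neighbours $u$ of $v$, and the maxima run over non-negative integers $k_u,l_u$, one pair for each $u$; over the empty set of neighbours they are $0$. - $\underline f_v(k,l)$ ($v$ inactive)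 is $0$ with empty sets if $k=0$, $l=0$ or $v$ is a leaf, and otherwise $\max\{\sum_u g_u(k_u,l_u):\sum_u k_u\le k,\ \sum_u l_u\le l\}$, where $g_u=\max\{\underline f_u,\overline f^b_u\}$ (preferring $\overline f^b_u$ in a tie) if $\overline f^b_u$ is defined and $g_u=\underline f_u$ otherwise. - $\overline f^a_v(k,l)$ ($v$ active, not a seed). For a social node $v$ it is defined if $k\le K_s-1$ and $1\le l\le K_p-1$, and is $w_v+\max\{\sum_u f_u(k_u,l_u):\sum_u k_u\le k,\ \sum_u l_u\le l-1\}$; $\bar v$ is added to the open nodes. For a dummy node $v$ it is defined if $v\ne r$, $k\le K_s-1$ and $l\le K_p-1$, and is $0$ with empty sets if $l=0$ and $\max\{\sum_u f_u(k_u,l_u):\sum_u k_u\le k,\ \sum_u l_u\le l\}$ if $l\ge1$. - $\overline f^b_v(k,l)$ ($v$ an active seed) is defined for social nodes $v$ if $k,l\ge1$, and is $w_v+\max\{\sum_u f_u(k_u,l_u):\sum_u k_u\le k-1,\ \sum_u l_u\le l-1\}$; $v$ is added to the seeds and $\bar v$ to the open nodes. - $\overline f_v(k,l)$ is the larger one of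 $\overline f^a_v(k,l)$ and $\overline f^b_v(k,l)$ that are defined (preferring $\overline f^a_v$ in a tie), and is undefined if neither is defined. - $f_v(k,l)$ is $\overline f_v(k,l)$ if this is defined and $\overline f_v(k,l)\ge\underline f_v(k,l)$, and $\underline f_v(k,l)$ otherwise. 4. Output the set of seeds and the set of open physical nodes stored with $f_r(K_s,K_p)$. **Theorem.** Under these assumptions the algorithm is optimal and runs in polynomial time: there are universal constants $C,d$ such that for every instance, every order in which its nodes and neighbours are listed in the input and every way of making the arbitrary selections, the algorithm never gets stuck, its output $(S,H)$ satisfies $|S|\le K_s$ and $|H|\le K_p$ and is optimal, and it performs at most $C\,N^d$ elementary steps (unit-cost model: array accesses, elementary list operations, and arithmetic and comparisons of indices and of real numbers have unit cost, and operations on whole lists or sets are charged their size). -/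

import Mathlib

namespace SocioPhysical

/-! ## The optimization problem -/

/-- An instance of the socio-physical influence maximization problem, with social nodes `V` and
physical nodes `W`. `graph.Adj i j` says that there is an edge from `i` to `j`; `cover l` is the
set of social nodes covered by the physical node `l`. -/
structure Problem (V W : Type) [Fintype V] [Fintype W] where
  graph : Digraph V
  weight : V → ℝ
  weight_pos : ∀ j, 0 < weight j
  threshold : V → ℕ
  threshold_pos : ∀ j, 1 ≤ threshold j
  cover : W → Finset V
  cover_nonempty : ∀ l, (cover l).Nonempty
  covered : ∀ j, ∃ l, j ∈ cover l
  seedBudget : ℕ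
  seedBudget_le : seedBudget ≤ Fintype.card V
  openBudget : ℕ
  openBudget_le : openBudget ≤ Fintype.card W

section Dynamics

variable {V W : Type} [Fintype V] [Fintype W]

open Classical in
/-- The social nodes that are active at time `t` when `S` is the set of seed nodes and `H` is the
set of open physical nodes (deterministic linear threshold dynamics). A social node can only ever
be active, at time `0` or later, if an open physical node covers it. -/
noncomputable def Problem.activeAt (P : Problem V W) (S : Finset V) (H : Finset W) : ℕ → Finset V
  | 0 => Finset.univ.filter fun j => j ∈ S ∧ ∃ l ∈ H, j ∈ P.cover l
  | t + 1 => Finset.univ.filter fun j =>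
      j ∈ P.activeAt S H t ∨
        ((∃ l ∈ H, j ∈ P.cover l) ∧
          P.threshold j ≤ ((P.activeAt S H t).filter fun i => P.graph.Adj i j).card)

/-- Total weight of the social nodes that eventually get activated, i.e. that are active at time
`N`, the number of social nodes. -/
noncomputable def Problem.eventualWeight (P : Problem V W) (S : Finset V) (H : Finset W) : ℝ :=
  ∑ j ∈ P.activeAt S H (Fintype.card V), P.weight j

/-- The sets `S` of seeds and `H` of open physical nodes respect the two budgets. -/
def Problem.IsFeasible (P : Problem V W) (S : Finset V) (H : Finset W) : Prop :=
  S.card ≤ P.seedBudget ∧ H.card ≤ P.openBudget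

def Problem.IsOptimal (P : Problem V W) (S : Finset V) (H : Finset W) : Prop :=
  P.IsFeasible S H ∧
    ∀ (S' : Finset V) (H' : Finset W), P.IsFeasible S' H' →
      P.eventualWeight S' H' ≤ P.eventualWeight S H

/-- All thresholds are `1`. -/
def Problem.UnitThresholds (P : Problem V W) : Prop := ∀ j, P.threshold j = 1

/-- Social and physical nodes correspond one to one: there are equally many, and every physical
node covers exactly one social node (that every social node is covered is part of `Problem`). -/
def Problem.OneToOneCover (P : Problem V W) : Prop :=
  Fintype.card W = Fintype.card V ∧ ∀ l, (P.cover l).card = 1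

end Dynamics

/-- A forest of out-trees: the underlying undirected graph is a forest, and each of its connected
components (a tree) has a root from which all edges of the component point away. The distance
condition also excludes loops and pairs of opposite edges. -/
def IsOutForest {V : Type} (G : Digraph V) : Prop :=
  G.toSimpleGraphInclusive.IsAcyclic ∧
    ∀ c : G.toSimpleGraphInclusive.ConnectedComponent, ∃ r ∈ c.supp,
      ∀ u ∈ c.supp, ∀ v, G.Adj u v →
        G.toSimpleGraphInclusive.dist r v = G.toSimpleGraphInclusive.dist r u + 1

/-! ## Nondeterministic programs with a step count

The cost model is unit cost: reading or writing an array cell (arrays are modelled by functions),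
elementary list operations, arithmetic and comparisons on indices and on real numbers, and making
an arbitrary selection each cost a constant number of steps. Operations on whole lists are charged
their length, operations on sets of social (physical) nodes are charged as operations on bit
vectors of length `|V|` (`|W|`). Up to constant factors, everything is charged. -/

/-- A program: it returns a result, spends one step, or spends one step to select arbitrarily one
of `n` alternatives. A program `pick 0 _` has nothing to select from and is stuck. -/
inductive Prog (α : Type) : Type
  | ret : α → Prog α
  | tick : Prog α → Prog α
  | pick : (n : ℕ) → (Fin n → Prog α) → Prog α

namespace Prog

/-- Sequential composition. -/
def bind {α β : Type} : Prog α → (α → Prog β) → Prog β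
  | ret a, f => f a
  | tick p, f => tick (p.bind f)
  | pick n k, f => pick n fun i => (k i).bind f

instance : Monad Prog where
  pure := ret
  bind := bind

/-- `p.Ensures post`: no run of `p` gets stuck, and whenever a run of `p` returns `a` after exactly
`t` steps, `post a t` holds. (All runs of a program are finite.) -/
def Ensures {α : Type} : Prog α → (α → ℕ → Prop) → Prop
  | ret a, post => post a 0
  | tick p, post => p.Ensures fun a t => post a (t + 1)
  | pick n k, post => 0 < n ∧ ∀ i, (k i).Ensures fun a t => post a (t + 1)

/-- The stuck program; it marks situations in which the algorithm would not be well defined, such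
as reading a value that has not been computed or not terminating within the allotted passes. -/
def fail {α : Type} : Prog α := pick 0 fun i => i.elim0

/-- Return `a`, spending `n` steps. -/
def charge {α : Type} : ℕ → α → Prog α
  | 0, a => ret a
  | n + 1, a => tick (charge n a)

/-- Return `a`, the result of one elementary operation. -/
def step {α : Type} (a : α) : Prog α := charge 1 a

/-- An elementary test. -/
def test (p : Prop) [Decidable p] : Prog Bool := step (decide p)

/-- Select an arbitrary member of a list and remove it from the list. -/
def pickOut {α : Type} (L : List α) : Prog (α × List α) :=
  pick L.length fun i => charge L.length (L.get i, L.eraseIdx i)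

/-- The members of a list that pass a test. -/
def filterList {α : Type} (p : α → Prog Bool) : List α → Prog (List α)
  | [] => step []
  | a :: as => do
      let b ← p a
      let bs ← filterList p as
      if b then step (a :: bs) else step bs

/-- Do all members of a list pass a test? -/
def allList {α : Type} (p : α → Prog Bool) : List α → Prog Bool
  | [] => step true
  | a :: as => do
      if ← p a then allList p as else step false

/-- Run through a list, updating a state. -/
def forList {α σ : Type} (body : α → σ → Prog σ) : List α → σ → Prog σ
  | [], s => step s
  | a :: as, s => do
      let s ← step s
      let s ← body a s
      forList body as s

/-- One pass through a list of candidates; `M` is the list of candidates so far whose value is the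
largest value `b` so far. -/
noncomputable def maximizers {ι : Type} (val : ι → Prog ℝ) : List ι → ℝ → List ι → Prog (List ι)
  | [], _, M => step M
  | c :: cs, b, M => do
      let x ← val c
      if ← test (b < x) then maximizers val cs x [c]
      else if ← test (x = b) then maximizers val cs b (c :: M)
      else maximizers val cs b M

/-- An arbitrary maximizer of `val` over a nonempty list of candidates. -/
noncomputable def argmax {ι : Type} (val : ι → Prog ℝ) : List ι → Prog ι
  | [] => fail
  | c :: cs => do
      let x ← val c
      let M ← maximizers val cs x [c]
      let p ← pickOut M
      step p.1

end Prog

/-! ## The algorithm -/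

/-- The data on which the algorithm operates. -/
structure Input (V W : Type) where
  nodes : List V
  out : V → List V
  coverers : V → List W
  weight : V → ℝ
  seedBudget : ℕ
  openBudget : ℕ

/-- `I` describes the instance `P`: it lists the social nodes, for every social node its outgoing
neighbours and the physical nodes that cover it (each list in an arbitrary order and without
repetitions), the weights and the budgets. -/
structure Input.Describes {V W : Type} [Fintype V] [Fintype W] (I : Input V W) (P : Problem V W) :
    Prop where
  nodes_nodup : I.nodes.Nodup
  mem_nodes : ∀ v, v ∈ I.nodes
  out_nodup : ∀ v, (I.out v).Nodup
  mem_out : ∀ v u, u ∈ I.out v ↔ P.graph.Adj v u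
  coverers_nodup : ∀ v, (I.coverers v).Nodup
  mem_coverers : ∀ v l, l ∈ I.coverers v ↔ v ∈ P.cover l
  weight_eq : I.weight = P.weight
  seedBudget_eq : I.seedBudget = P.seedBudget
  openBudget_eq : I.openBudget = P.openBudget

/-- Nodes of the modified networks: social nodes `Sum.inl v` and dummy nodes `Sum.inr n`. -/
abbrev Node (V : Type) : Type := V ⊕ ℕ

/-- A network under construction: its nodes, its adjacency lists, and the number of dummy nodes
constructed so far. -/
structure Net (V : Type) where
  nodes : List (Node V)
  out : Node V → List (Node V)
  dummies : ℕ

section Construction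

variable {V : Type} [DecidableEq V]

/-- Replace the list of outgoing neighbours of `j`. -/
def Net.setOut (net : Net V) (j : Node V) (L : List (Node V)) : Prog (Net V) :=
  Prog.step { net with out := Function.update net.out j L }

/-- Construct an edge from `j` to `m`. -/
def Net.addEdge (net : Net V) (j m : Node V) : Prog (Net V) := do
  let L ← Prog.step (net.out j)
  net.setOut j (m :: L)

/-- Construct a new dummy node, without edges. -/
def Net.addDummy (net : Net V) : Prog (Node V × Net V) := do
  let d ← Prog.step (Sum.inr net.dummies)
  let net ← Prog.step { net with nodes := d :: net.nodes, dummies := net.dummies + 1 }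
  let net ← net.setOut d []
  Prog.step (d, net)

/-- Attach the `x` nodes of `L` below `j` along a chain of dummy nodes. If `x = 2`, construct
edges from `j` to both nodes of `L`. If `x > 2`, construct an edge from `j` to an arbitrary `m` in
`L`, remove `m` from `L`, construct a dummy node `d` and an edge from `j` to `d`, and continue with
`d` instead of `j`. -/
def attach : ℕ → Node V → List (Node V) → Net V → Prog (Net V)
  | 0, _, _, net => Prog.step net
  | 1, _, _, net => Prog.step net
  | 2, j, L, net => Prog.forList (fun m net => net.addEdge j m) L net
  | x + 3, j, L, net => do
      let p ← Prog.pickOut L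
      let net ← net.addEdge j p.1
      let q ← net.addDummy
      let net ← q.2.addEdge j q.1
      attach (x + 2) q.1 p.2 net

/-- As long as there are nodes with more than two outgoing neighbours, select arbitrarily such a
node `i`, remove its outgoing edges, and attach its former outgoing neighbours below it along a
chain of dummy nodes. The first argument bounds the number of passes. The nodes may be selected in
any order; treating the out-trees of a forest one after the other is one of the possibilities. -/
def binarize : ℕ → Net V → Prog (Net V)
  | 0, _ => Prog.fail
  | n + 1, net => do
      let big ← Prog.filterList
        (fun v => Prog.charge ((net.out v).length + 1) (decide (2 < (net.out v).length))) net.nodes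
      match big with
      | [] => Prog.step net
      | _ :: _ => do
          let p ← Prog.pickOut big
          let L ← Prog.step (net.out p.1)
          let x ← Prog.charge (L.length + 1) L.length
          let net ← net.setOut p.1 []
          let net ← attach x p.1 L net
          binarize n net

/-- The nodes without incoming edges. -/
def findRoots (net : Net V) : Prog (List (Node V)) := do
  let isChild ← Prog.forList
    (fun v (mark : Node V → Bool) =>
      Prog.forList (fun u mark => Prog.step (Function.update mark u true)) (net.out v) mark)
    net.nodes (fun _ => false)
  Prog.filterList (fun v => Prog.step (!isChild v)) net.nodes

/-- Join the out-trees of a forest into a single out-tree with the help of dummy nodes, unless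
there is only one. Returns the root and the network. -/
def joinTrees (net : Net V) : Prog (Node V × Net V) := do
  let roots ← findRoots net
  match roots with
  | [] => Prog.fail
  | [r] => Prog.step (r, net)
  | _ :: _ :: _ => do
      let q ← net.addDummy
      let x ← Prog.charge (roots.length + 1) roots.length
      let net ← attach x q.1 roots q.2
      Prog.step (q.1, net)

end Construction

/-- A value together with a set of seed nodes and a set of open physical nodes. -/
structure Sol (V W : Type) where
  val : ℝ
  seeds : Finset V
  opened : Finset W

/-- What the dynamic program computes for a node `v` and budgets `k`, `l`: best solutions for the
out-tree rooted at `v` in which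
* `lo`: `v` is inactive;
* `actA`: `v` is active but not a seed (where defined);
* `actB`: `v` is active and a seed (where defined);
* `act`: `v` is active (where defined);
* `opt`: there is no restriction. -/
structure Cell (V W : Type) where
  lo : Sol V W
  actA : Option (Sol V W)
  actB : Option (Sol V W)
  act : Option (Sol V W)
  opt : Sol V W

/-- The table of the dynamic program; `none` marks a cell that has not been computed. -/
abbrev Table (V W : Type) : Type := Node V → ℕ → ℕ → Option (Cell V W)

section DynamicProgram

variable {V W : Type} [Fintype V] [Fintype W] [DecidableEq V] [DecidableEq W]

/-- Read a cell that has been computed. -/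
def Table.read (T : Table V W) (v : Node V) (k l : ℕ) : Prog (Cell V W) := do
  match ← Prog.step (T v k l) with
  | some c => Prog.step c
  | none => Prog.fail

def Table.write (T : Table V W) (v : Node V) (k l : ℕ) (c : Cell V W) : Prog (Table V W) :=
  Prog.step (Function.update T v
    (Function.update (T v) k (Function.update (T v k) l (some c))))

/-- The solution of value `0` without seeds and open physical nodes. -/
def Sol.zero : Prog (Sol V W) :=
  Prog.charge (1 + Fintype.card V + Fintype.card W) ⟨0, ∅, ∅⟩

/-- Add the values and unite the sets. -/
noncomputable def Sol.join (s t : Sol V W) : Prog (Sol V W) :=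
  Prog.charge (1 + Fintype.card V + Fintype.card W)
    ⟨s.val + t.val, s.seeds ∪ t.seeds, s.opened ∪ t.opened⟩

/-- Add the social node `x` with weight `a`, covered by the physical node `y` which is opened. -/
noncomputable def Sol.addActive (s : Sol V W) (a : ℝ) (y : W) : Prog (Sol V W) :=
  Prog.charge (1 + Fintype.card W) ⟨a + s.val, s.seeds, insert y s.opened⟩

/-- Add `x` to the seed nodes. -/
def Sol.addSeed (s : Sol V W) (x : V) : Prog (Sol V W) :=
  Prog.charge (1 + Fintype.card V) ⟨s.val, insert x s.seeds, s.opened⟩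

/-- The unrestricted solution at a node (the quantity called `f`). -/
def readOpt (T : Table V W) (u : Node V) (k l : ℕ) : Prog (Sol V W) := do
  let c ← T.read u k l
  Prog.step c.opt

/-- The best solution at a node whose predecessor is inactive (the quantity called `g`): the node
is inactive or is an active seed. -/
noncomputable def readUnsupported (T : Table V W) (u : Node V) (k l : ℕ) : Prog (Sol V W) := do
  let c ← T.read u k l
  match c.actB with
  | none => Prog.step c.lo
  | some b => if ← Prog.test (c.lo.val ≤ b.val) then Prog.step b else Prog.step c.lo

/-- The pairs `(k₁, k₂)` with `k₁ + k₂ ≤ k`. -/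
def pairs (k : ℕ) : List (ℕ × ℕ) :=
  (List.range (k + 1) ×ˢ List.range (k + 1)).filter fun p => p.1 + p.2 ≤ k

/-- Distribute at most `k` seed nodes and at most `l` open physical nodes among the out-trees of
the outgoing neighbours so that the sum of the values of `F` is maximal; any maximizer may be
chosen. With one outgoing neighbour, its share is `(k₁, l₁)` with `k₁ ≤ k` and `l₁ ≤ l`. -/
noncomputable def bestSplit (F : Node V → ℕ → ℕ → Prog (Sol V W)) (us : List (Node V)) (k l : ℕ) :
    Prog (Sol V W) :=
  match us with
  | [u] => do
      let cands ← Prog.charge ((k + 1) * (l + 1)) (List.range (k + 1) ×ˢ List.range (l + 1))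
      let c ← Prog.argmax (fun c => do
        let s ← F u c.1 c.2
        Prog.step s.val) cands
      F u c.1 c.2
  | [u₁, u₂] => do
      let cands ← Prog.charge ((k + 1) ^ 2 * (l + 1) ^ 2) (pairs k ×ˢ pairs l)
      let c ← Prog.argmax (fun c => do
        let s₁ ← F u₁ c.1.1 c.2.1
        let s₂ ← F u₂ c.1.2 c.2.2
        Prog.step (s₁.val + s₂.val)) cands
      let s₁ ← F u₁ c.1.1 c.2.1
      let s₂ ← F u₂ c.1.2 c.2.2
      s₁.join s₂
  | _ => Prog.fail

/-- The physical node that corresponds to the social node `x`. -/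
def physOf (I : Input V W) (x : V) : Prog W := do
  match ← Prog.step (I.coverers x) with
  | [] => Prog.fail
  | y :: _ => Prog.step y

/-- Best solution with `v` inactive; `us` is the list of outgoing neighbours of `v`. -/
noncomputable def computeLo (T : Table V W) (us : List (Node V)) (k l : ℕ) : Prog (Sol V W) := do
  if ← Prog.test (k = 0 ∨ l = 0) then Sol.zero
  else if ← Prog.test (us = []) then Sol.zero
  else bestSplit (readUnsupported T) us k l

/-- Solutions below an active social node, with budgets `k`, `l` for the proper descendants. -/
noncomputable def below (T : Table V W) (us : List (Node V)) (k l : ℕ) : Prog (Sol V W) := do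
  if ← Prog.test (us = []) then Sol.zero else bestSplit (readOpt T) us k l

/-- Best solution with `v` active but not a seed; `r` is the root. For a social node it is defined
if `k ≤ K_s - 1` and `1 ≤ l ≤ K_p - 1`, for a dummy node if `v ≠ r`, `k ≤ K_s - 1` and
`l ≤ K_p - 1`. -/
noncomputable def computeActA (I : Input V W) (T : Table V W) (r v : Node V) (us : List (Node V))
    (k l : ℕ) : Prog (Option (Sol V W)) :=
  match v with
  | Sum.inl x => do
      if ← Prog.test (k < I.seedBudget ∧ 1 ≤ l ∧ l < I.openBudget) then
        let s ← below T us k (l - 1)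
        let y ← physOf I x
        let s ← s.addActive (I.weight x) y
        Prog.step (some s)
      else Prog.step none
  | Sum.inr _ => do
      if ← Prog.test (v ≠ r ∧ k < I.seedBudget ∧ l < I.openBudget) then
        if ← Prog.test (l = 0) then
          let s ← Sol.zero
          Prog.step (some s)
        else
          let s ← bestSplit (readOpt T) us k l
          Prog.step (some s)
      else Prog.step none

/-- Best solution with `v` active and a seed. It is defined for social nodes if `k ≥ 1` and
`l ≥ 1`. -/
noncomputable def computeActB (I : Input V W) (T : Table V W) (v : Node V) (us : List (Node V))
    (k l : ℕ) : Prog (Option (Sol V W)) :=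
  match v with
  | Sum.inl x => do
      if ← Prog.test (1 ≤ k ∧ 1 ≤ l) then
        let s ← below T us (k - 1) (l - 1)
        let y ← physOf I x
        let s ← s.addActive (I.weight x) y
        let s ← s.addSeed x
        Prog.step (some s)
      else Prog.step none
  | Sum.inr _ => Prog.step none

/-- The better of the solutions with `v` active, where defined. -/
noncomputable def computeAct : Option (Sol V W) → Option (Sol V W) → Prog (Option (Sol V W))
  | none, none => Prog.step none
  | some a, none => Prog.step (some a)
  | none, some b => Prog.step (some b)
  | some a, some b => do
      if ← Prog.test (b.val ≤ a.val) then Prog.step (some a) else Prog.step (some b)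

/-- The better of the solutions with `v` active, if defined, and with `v` inactive. -/
noncomputable def computeOpt : Option (Sol V W) → Sol V W → Prog (Sol V W)
  | none, lo => Prog.step lo
  | some a, lo => do
      if ← Prog.test (lo.val ≤ a.val) then Prog.step a else Prog.step lo

noncomputable def computeCell (I : Input V W) (T : Table V W) (r v : Node V) (us : List (Node V))
    (k l : ℕ) : Prog (Cell V W) := do
  let lo ← computeLo T us k l
  let a ← computeActA I T r v us k l
  let b ← computeActB I T v us k l
  let act ← computeAct a b
  let opt ← computeOpt act lo
  Prog.step ⟨lo, a, b, act, opt⟩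

/-- Compute the cells of `v` for all `0 ≤ k ≤ K_s` and `0 ≤ l ≤ K_p`. -/
noncomputable def computeNode (I : Input V W) (net : Net V) (r v : Node V) (T : Table V W) :
    Prog (Table V W) := do
  let us ← Prog.step (net.out v)
  Prog.forList (fun k T =>
    Prog.forList (fun l T => do
      let c ← computeCell I T r v us k l
      T.write v k l c) (List.range (I.openBudget + 1)) T) (List.range (I.seedBudget + 1)) T

/-- State of the dynamic program: the table, and the nodes for which it has been computed. -/
structure DPState (V W : Type) where
  table : Table V W
  finished : Node V → Bool

noncomputable def visit (I : Input V W) (net : Net V) (r v : Node V) (st : DPState V W) :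
    Prog (DPState V W) := do
  let T ← computeNode I net r v st.table
  Prog.step ⟨T, Function.update st.finished v true⟩

/-- As long as there are nodes that have not been computed, select arbitrarily one of them all of
whose outgoing neighbours have been computed, and compute it. The first argument bounds the number
of passes. -/
noncomputable def dpLoop (I : Input V W) (net : Net V) (r : Node V) :
    ℕ → DPState V W → Prog (DPState V W)
  | 0, _ => Prog.fail
  | n + 1, st => do
      let todo ← Prog.filterList (fun v => Prog.step (!st.finished v)) net.nodes
      match todo with
      | [] => Prog.step st
      | _ :: _ => do
          let ready ← Prog.filterList
            (fun v => Prog.allList (fun u => Prog.step (st.finished u)) (net.out v)) todo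
          let p ← Prog.pickOut ready
          let st ← visit I net r p.1 st
          dpLoop I net r n st

/-- The dynamic program on an out-tree with root `r` in which every node has at most two outgoing
neighbours: first the leaves, then the remaining nodes, then the solution at the root. -/
noncomputable def dynamicProgram (I : Input V W) (net : Net V) (r : Node V) :
    Prog (Finset V × Finset W) := do
  let leaves ← Prog.filterList (fun v => Prog.test (net.out v = [])) net.nodes
  let st ← Prog.forList (fun v st => visit I net r v st) leaves ⟨fun _ _ _ => none, fun _ => false⟩
  let passes ← Prog.charge (net.nodes.length + 1) (net.nodes.length + 1)
  let st ← dpLoop I net r passes st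
  let c ← st.table.read r I.seedBudget I.openBudget
  Prog.step (c.opt.seeds, c.opt.opened)

/-- The input graph as a network without dummy nodes. -/
def initialNet (I : Input V W) : Prog (Net V) := do
  let nodes ← Prog.charge (I.nodes.length + 1) (I.nodes.map Sum.inl)
  let out ← Prog.forList (fun v (out : Node V → List (Node V)) =>
    Prog.charge ((I.out v).length + 1)
      (Function.update out (Sum.inl v) ((I.out v).map Sum.inl))) I.nodes (fun _ => [])
  Prog.step ⟨nodes, out, 0⟩

/-- The algorithm for forests of out-trees. It outputs the set of seed nodes and the set of
physical nodes to be opened. -/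
noncomputable def forestAlgorithm (I : Input V W) : Prog (Finset V × Finset W) := do
  let net ← initialNet I
  let passes ← Prog.charge (I.nodes.length + 1) (I.nodes.length + 1)
  let net ← binarize passes net
  let q ← joinTrees net
  dynamicProgram I q.2 q.1

end DynamicProgram

end SocioPhysical

namespace SocioPhysical

/-! ## Bounded runs of programs -/

namespace Prog

variable {α β σ : Type}

/-! With unit thresholds and one physical node per social node, a pair (S, H) matters only through
the set A of nodes that end up active. In a forest of out-trees, A is realizable exactly if every
member is opened and is a seed or has its parent in A (`Problem.Rooted.subset_activeAt`,
`Problem.Rooted.supported_activeAt`). The cheapest realization opens |A| physical nodes and seeds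
the `heads` of A, the members whose parent is not in A. So the task is to maximize the weight of A
subject to |heads A| ≤ K_s and |A| ≤ K_p.

In the binarized tree a dummy node stands for its owner, the nearest social node above it; `NetInv`
says that merging dummies into their owners gives back the original forest. A dummy therefore counts
as active exactly when its owner does, so its own state (`ownerOf`) and the state above it
(`predOf`) coincide, whereas for a social node they are independent.

The dynamic program is verified by two one-sided estimates for each of g and f, collected in
`Cell.Correct`. Soundness: the stored sets respect the budgets and realize the stored value,
possibly relying on an active social node above. Maximality: for one fixed global A, whose heads and
members inside the subtree fit into k and l, the weight of A in that subtree is at most the stored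
value. Since A is global, its counts add exactly over the disjoint subtrees of the children, and no
exchange argument is needed (`dominated_join`).

The delicate quantity is f, which may store a solution whose top node is active without a seed. It
is sound if there is a social node above to provide support, and also at the root for k = K_s, where
the unseeded alternative is undefined. Below a dummy root some values of f may be unsound, but they
enter neither any g nor the final value. Conversely f is maximal only for k < K_s and l < K_p; these
are the only budgets for which maximality is needed, because activating a social node spends one
opening and a seed also spends one unit of k. At the root, g ≤ f and maximality of g finish the
proof (`Setting.isOptimal_of_correct`).

No run gets stuck because `rank` strictly increases along edges: a node of least rank is a root, and
an unfinished node of greatest rank is ready. The judgement `Prog.Within` carries correctness,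
progress and a step bound together, and the bounds add up to the polynomial `totalCost`. -/

theorem Ensures.mono {p : Prog α} {post post' : α → ℕ → Prop} (h : p.Ensures post)
    (hp : ∀ a t, post a t → post' a t) : p.Ensures post' := by
  induction p generalizing post post' with
  | ret a => exact hp _ _ h
  | tick p ih => exact ih h fun a t => hp a (t + 1)
  | pick n k ih => exact ⟨h.1, fun i => ih i (h.2 i) fun a t => hp a (t + 1)⟩

theorem Ensures.bind {p : Prog α} {f : α → Prog β} {post : β → ℕ → Prop}
    (h : p.Ensures fun a t => (f a).Ensures fun b s => post b (t + s)) :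
    (p >>= f).Ensures post := by
  change (Prog.bind p f).Ensures post
  induction p generalizing post with
  | ret a => simpa [Ensures, Prog.bind] using h
  | tick p ih =>
      exact ih (Ensures.mono (p := p) h fun a t ha => ha.mono fun b s hb => by
        rwa [add_right_comm] at hb)
  | pick n k ih =>
      refine ⟨h.1, fun i => ih i ((h.2 i).mono fun a t ha => ha.mono fun b s hb => ?_)⟩
      rwa [add_right_comm] at hb

/-- No run of `p` gets stuck or takes more than `B` steps, and all results satisfy `Q`. -/
def Within (p : Prog α) (B : ℕ) (Q : α → Prop) : Prop :=
  p.Ensures fun a t => Q a ∧ t ≤ B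

theorem Within.mono {p : Prog α} {B B' : ℕ} {Q Q' : α → Prop} (h : p.Within B Q) (hB : B ≤ B')
    (hQ : ∀ a, Q a → Q' a) : p.Within B' Q' :=
  Ensures.mono h fun a _ ha => ⟨hQ a ha.1, ha.2.trans hB⟩

theorem Within.le {p : Prog α} {B B' : ℕ} {Q : α → Prop} (h : p.Within B Q) (hB : B ≤ B') :
    p.Within B' Q := h.mono hB fun _ => id

theorem Within.bind {p : Prog α} {f : α → Prog β} {B₁ B₂ : ℕ} {Q : α → Prop} {R : β → Prop}
    (hp : p.Within B₁ Q) (hf : ∀ a, Q a → (f a).Within B₂ R) :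
    (p >>= f).Within (B₁ + B₂) R :=
  Ensures.bind <| Ensures.mono hp fun a _ ha =>
    Ensures.mono (hf a ha.1) fun _ _ hb => ⟨hb.1, add_le_add ha.2 hb.2⟩

/-- Sequential composition in which the budget of the second program is what the first leaves. -/
theorem Within.bind_le {p : Prog α} {f : α → Prog β} {B : ℕ} (B₁ : ℕ) {Q : α → Prop}
    {R : β → Prop} (hB : B₁ ≤ B) (hp : p.Within B₁ Q)
    (hf : ∀ a, Q a → (f a).Within (B - B₁) R) : (p >>= f).Within B R :=
  (hp.bind hf).le (by omega)

theorem within_ret {a : α} {B : ℕ} {Q : α → Prop} (h : Q a) : (ret a).Within B Q :=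
  ⟨h, Nat.zero_le _⟩

theorem within_charge {a : α} {n B : ℕ} {Q : α → Prop} (h : Q a) (hB : n ≤ B) :
    (charge n a).Within B Q := by
  induction n generalizing B with
  | zero => exact within_ret h
  | succ n ih =>
      refine Ensures.mono (p := charge n a) (ih (B := B - 1) (by omega)) fun a t ha => ⟨ha.1, ?_⟩
      have := ha.2; omega

theorem within_step {a : α} {B : ℕ} {Q : α → Prop} (h : Q a) (hB : 1 ≤ B) :
    (step a).Within B Q := within_charge h hB

theorem within_charge_bind {a : α} {f : α → Prog β} {n B : ℕ} {R : β → Prop} (hB : n ≤ B)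
    (h : (f a).Within (B - n) R) : (charge n a >>= f).Within B R :=
  Within.bind_le n hB (within_charge (Q := fun b => b = a) rfl le_rfl) fun _ hb => hb ▸ h

theorem within_step_bind {a : α} {f : α → Prog β} {B : ℕ} {R : β → Prop} (hB : 1 ≤ B)
    (h : (f a).Within (B - 1) R) : (step a >>= f).Within B R :=
  within_charge_bind hB h

theorem within_ite_test {p : Prop} [Decidable p] {x y : Prog β} {B : ℕ} {R : β → Prop}
    (hB : 1 ≤ B) (hx : p → x.Within (B - 1) R) (hy : ¬ p → y.Within (B - 1) R) :
    (test p >>= fun b => if b = true then x else y).Within B R := by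
  refine within_step_bind hB ?_
  by_cases h : p <;> simp [h, hx, hy]

theorem within_pickOut {L : List α} (hL : L ≠ []) {B : ℕ} (hB : L.length + 1 ≤ B) :
    (pickOut L).Within B fun q => L.Perm (q.1 :: q.2) := by
  refine ⟨List.length_pos_iff.2 hL, fun i => ?_⟩
  refine Ensures.mono (within_charge (Q := fun q => L.Perm (q.1 :: q.2)) (B := L.length) ?_ le_rfl)
    fun a t ha => ⟨ha.1, by have := ha.2; omega⟩
  exact (List.getElem_cons_eraseIdx_perm i.2).symm

theorem within_filterList {p : α → Prog Bool} {P : α → Bool} {b B : ℕ} {L : List α}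
    (h : ∀ a ∈ L, (p a).Within b fun x => x = P a) (hB : L.length * (b + 1) + 1 ≤ B) :
    (filterList p L).Within B fun r => r = L.filter P := by
  induction L generalizing B with
  | nil => exact within_step rfl (by omega)
  | cons a as ih =>
      simp only [List.length_cons, add_mul, one_mul] at hB
      refine Within.bind_le b (by omega) (h a (by simp)) ?_
      rintro _ rfl
      refine Within.bind_le (as.length * (b + 1) + 1) (by omega)
        (ih (fun a ha => h a (by simp [ha])) le_rfl) ?_
      rintro _ rfl
      have : 1 ≤ B - b - (as.length * (b + 1) + 1) := by omega
      by_cases hP : P a <;> simp only [hP, if_true] <;>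
        exact within_step (by simp [hP]) this

theorem within_allList {p : α → Prog Bool} {P : α → Bool} {b B : ℕ} {L : List α}
    (h : ∀ a ∈ L, (p a).Within b fun x => x = P a) (hB : L.length * b + 1 ≤ B) :
    (allList p L).Within B fun r => r = L.all P := by
  induction L generalizing B with
  | nil => exact within_step rfl (by omega)
  | cons a as ih =>
      simp only [List.length_cons, add_mul, one_mul] at hB
      refine Within.bind_le b (by omega) (h a (by simp)) ?_
      rintro _ rfl
      by_cases hP : P a
      · simp only [hP, if_true]
        exact (ih (fun a ha => h a (by simp [ha])) (by omega)).mono le_rfl (by simp [hP])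
      · simp only [hP]
        exact within_step (by simp [hP]) (by omega)

/-- Loops preserve invariants, which may refer to the list of the members still to be treated. -/
theorem within_forList {body : α → σ → Prog σ} {b B : ℕ} (Inv : List α → σ → Prop) {L : List α}
    {s : σ} (h0 : Inv L s)
    (h : ∀ a as s, (a :: as) <:+ L → Inv (a :: as) s → (body a s).Within b (Inv as))
    (hB : L.length * (b + 1) + 1 ≤ B) : (forList body L s).Within B (Inv []) := by
  induction L generalizing s B with
  | nil => exact within_step h0 (by omega)
  | cons a as ih =>
      simp only [List.length_cons, add_mul, one_mul] at hB
      refine within_step_bind (by omega) ?_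
      refine Within.bind_le b (by omega) (h a as s List.suffix_rfl h0) fun s' hs' => ?_
      exact ih hs' (fun a' as' s ht => h a' as' s (ht.trans (List.suffix_cons a as))) (by omega)

/-- The list `seen` occurs only in the proof: it records the candidates already treated, so that `M`
is a nonempty list of elements of `seen` that attain the maximum `x` of φ on it. -/
theorem within_maximizers {ι : Type} {val : ι → Prog ℝ} {φ : ι → ℝ} {b B : ℕ} {cs M seen : List ι}
    {x : ℝ} (h : ∀ c ∈ cs, (val c).Within b fun y => y = φ c) (hM : M ≠ [])
    (hx : ∀ c ∈ M, c ∈ seen ∧ φ c = x) (hs : ∀ c ∈ seen, φ c ≤ x)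
    (hB : cs.length * (b + 2) + 1 ≤ B) :
    (maximizers val cs x M).Within B fun R => R ≠ [] ∧ R.length ≤ M.length + cs.length ∧
      ∀ c ∈ R, c ∈ seen ++ cs ∧ ∀ c' ∈ seen ++ cs, φ c' ≤ φ c := by
  induction cs generalizing x M seen B with
  | nil =>
      refine within_step ⟨hM, by simp, fun c hc => ?_⟩ (by omega)
      simp only [List.append_nil]
      exact ⟨(hx c hc).1, fun c' hc' => (hx c hc).2 ▸ hs c' hc'⟩
  | cons a as ih =>
      simp only [List.length_cons, add_mul, one_mul] at hB
      refine Within.bind_le b (by omega) (h a (by simp)) ?_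
      rintro _ rfl
      have h' : ∀ c ∈ as, (val c).Within b fun y => y = φ c := fun c hc => h c (by simp [hc])
      have e : ∀ c, c ∈ (seen ++ [a]) ++ as ↔ c ∈ seen ++ a :: as := by simp
      have key : ∀ {R : List ι} {m : ℕ}, m ≤ M.length + 1 →
          (R ≠ [] ∧ R.length ≤ m + as.length ∧ ∀ c ∈ R, c ∈ (seen ++ [a]) ++ as ∧
            ∀ c' ∈ (seen ++ [a]) ++ as, φ c' ≤ φ c) →
          R ≠ [] ∧ R.length ≤ M.length + (a :: as).length ∧ ∀ c ∈ R, c ∈ seen ++ a :: as ∧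
            ∀ c' ∈ seen ++ a :: as, φ c' ≤ φ c := by
        intro R m hm hR
        simp only [e] at hR
        refine ⟨hR.1, ?_, hR.2.2⟩
        have := hR.2.1
        simp only [List.length_cons]; omega
      have hML : 1 ≤ M.length := List.length_pos_iff.2 hM
      refine within_ite_test (by omega) (fun hlt => ?_) fun hle => ?_
      · refine (ih (M := [a]) (seen := seen ++ [a]) h' (by simp) (by simp) ?_ (by omega)).mono le_rfl
          fun R hR => key (by simp) hR
        intro c hc
        rcases List.mem_append.1 hc with hc | hc
        · exact (hs c hc).trans hlt.le
        · rw [List.mem_singleton.1 hc]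
      · refine within_ite_test (by omega) (fun heq => ?_) fun hne => ?_
        · refine (ih (M := a :: M) (seen := seen ++ [a]) h' (by simp) ?_ ?_ (by omega)).mono le_rfl
            fun R hR => key (by simp) hR
          · intro c hc
            rcases List.mem_cons.1 hc with rfl | hc
            · simp [heq]
            · simp [(hx c hc).1, (hx c hc).2]
          · intro c hc
            rcases List.mem_append.1 hc with hc | hc
            · exact hs c hc
            · rw [List.mem_singleton.1 hc, heq]
        · refine (ih (M := M) (seen := seen ++ [a]) h' hM ?_ ?_ (by omega)).mono le_rfl
            fun R hR => key (by simp) hR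
          · intro c hc
            simp [(hx c hc).1, (hx c hc).2]
          · intro c hc
            rcases List.mem_append.1 hc with hc | hc
            · exact hs c hc
            · rw [List.mem_singleton.1 hc]; exact not_lt.1 hle

theorem within_argmax {ι : Type} {val : ι → Prog ℝ} {φ : ι → ℝ} {b B : ℕ} {cs : List ι}
    (hcs : cs ≠ []) (h : ∀ c ∈ cs, (val c).Within b fun y => y = φ c)
    (hB : cs.length * (b + 3) + 3 ≤ B) :
    (argmax val cs).Within B fun c => c ∈ cs ∧ ∀ c' ∈ cs, φ c' ≤ φ c := by
  cases cs with
  | nil => exact absurd rfl hcs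
  | cons a as =>
      simp only [List.length_cons, add_mul, one_mul, mul_add] at hB
      refine Within.bind_le b (by omega) (h a (by simp)) ?_
      rintro _ rfl
      refine Within.bind_le (as.length * (b + 2) + 1) (by simp only [mul_add]; omega)
        (within_maximizers (seen := [a]) (fun c hc => h c (by simp [hc])) (by simp) (by simp)
          (by simp) le_rfl) fun M hM => ?_
      have hM2 := hM.2.1
      simp only [List.length_singleton] at hM2
      refine Within.bind_le (M.length + 1) (by simp only [mul_add]; omega)
        (within_pickOut hM.1 le_rfl) fun q hq => ?_
      refine within_step ?_ (by simp only [mul_add]; omega)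
      exact hM.2.2 q.1 (hq.symm.subset (by simp))

end Prog

/-! ## Forests of out-trees and the resulting activations -/

section Forest

variable {V : Type} {G : Digraph V}

theorem IsOutForest.exists_root (h : IsOutForest G) (x : V) :
    ∃ r, G.toSimpleGraphInclusive.Reachable r x ∧
      ∀ u v, G.toSimpleGraphInclusive.Reachable r u → G.Adj u v →
        G.toSimpleGraphInclusive.dist r v = G.toSimpleGraphInclusive.dist r u + 1 := by
  obtain ⟨r, hr, H⟩ := h.2 (G.toSimpleGraphInclusive.connectedComponentMk x)
  rw [SimpleGraph.ConnectedComponent.mem_supp_iff] at hr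
  refine ⟨r, SimpleGraph.ConnectedComponent.exact hr, fun u v hu huv => H u ?_ v huv⟩
  rw [SimpleGraph.ConnectedComponent.mem_supp_iff, ← hr]
  exact SimpleGraph.ConnectedComponent.sound hu.symm

theorem IsOutForest.ne_of_adj (h : IsOutForest G) {u v : V} (huv : G.Adj u v) : u ≠ v := by
  rintro rfl
  obtain ⟨r, hr, H⟩ := h.exists_root u
  have := H u u hr huv
  omega

theorem IsOutForest.inclusive_adj (h : IsOutForest G) {u v : V} (huv : G.Adj u v) :
    G.toSimpleGraphInclusive.Adj u v :=
  (SimpleGraph.fromRel_adj _ _ _).2 ⟨h.ne_of_adj huv, Or.inl huv⟩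

/-- The depth is the distance from the root of the component. A geodesic is a path and has distinct
vertices, which gives the strict bound. -/
theorem IsOutForest.exists_depth [Fintype V] (h : IsOutForest G) :
    ∃ depth : V → ℕ, (∀ u v, G.Adj u v → depth v = depth u + 1) ∧
      ∀ v, depth v < Fintype.card V := by
  classical
  choose root hroot using fun c : G.toSimpleGraphInclusive.ConnectedComponent => h.2 c
  let comp := G.toSimpleGraphInclusive.connectedComponentMk
  refine ⟨fun x => G.toSimpleGraphInclusive.dist (root (comp x)) x, fun u v huv => ?_, fun v => ?_⟩
  · have e : comp v = comp u :=
      SimpleGraph.ConnectedComponent.sound (h.inclusive_adj huv).reachable.symm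
    simp only [e]
    exact (hroot (comp u)).2 u rfl v huv
  · have hr : G.toSimpleGraphInclusive.Reachable (root (comp v)) v :=
      SimpleGraph.ConnectedComponent.exact
        ((SimpleGraph.ConnectedComponent.mem_supp_iff _ _).1 (hroot (comp v)).1)
    obtain ⟨p, hp, hl⟩ := hr.exists_path_of_dist
    exact hl.symm.trans_lt hp.length_lt

/-- Geodesics from the root to u and to u' remain geodesics when extended by the edge to v. Both
extensions are paths, paths in a forest are unique, and so their penultimate vertices agree. -/
theorem IsOutForest.adj_unique (h : IsOutForest G) {u u' v : V} (hu : G.Adj u v)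
    (hu' : G.Adj u' v) : u = u' := by
  obtain ⟨r, hr, H⟩ := h.exists_root v
  have au := h.inclusive_adj hu
  have au' := h.inclusive_adj hu'
  have ru := hr.trans au.symm.reachable
  have ru' := hr.trans au'.symm.reachable
  obtain ⟨p, hp⟩ := ru.exists_walk_length_eq_dist
  obtain ⟨p', hp'⟩ := ru'.exists_walk_length_eq_dist
  have q := (p.concat au).isPath_of_length_eq_dist
    (by rw [SimpleGraph.Walk.length_concat, hp, H u v ru hu])
  have q' := (p'.concat au').isPath_of_length_eq_dist
    (by rw [SimpleGraph.Walk.length_concat, hp', H u' v ru' hu'])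
  have e := congrArg (fun w : G.toSimpleGraphInclusive.Path r v => (w : _).1.penultimate)
    ((h.1.subsingleton_path r v).elim ⟨_, q⟩ ⟨_, q'⟩)
  simpa using e

end Forest

section Rooted

variable {V W : Type} [Fintype V] [Fintype W]

/-- Parents, depths and corresponding physical nodes in an instance on a forest of out-trees in
which social and physical nodes correspond one to one. -/
structure Problem.Rooted (P : Problem V W) (par : V → Option V) (depth : V → ℕ) (phys : V → W) :
    Prop where
  adj_iff : ∀ p x, P.graph.Adj p x ↔ par x = some p
  depth_eq : ∀ p x, par x = some p → depth x = depth p + 1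
  depth_lt : ∀ x, depth x < Fintype.card V
  mem_cover : ∀ x l, x ∈ P.cover l ↔ l = phys x
  phys_injective : Function.Injective phys
  threshold_eq : ∀ x, P.threshold x = 1
  card_eq : Fintype.card W = Fintype.card V

/-- Coverage makes the map from a physical node to the single node it covers surjective, and equal
cardinalities make it bijective; `phys` is its inverse. -/
theorem Problem.exists_rooted (P : Problem V W) (hT : P.UnitThresholds) (hC : P.OneToOneCover)
    (hG : IsOutForest P.graph) : ∃ par depth phys, P.Rooted par depth phys := by
  classical
  obtain ⟨depth, hd, hlt⟩ := hG.exists_depth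
  let par : V → Option V := fun x => if h : ∃ p, P.graph.Adj p x then some h.choose else none
  have hpar : ∀ p x, P.graph.Adj p x ↔ par x = some p := by
    intro p x
    by_cases h : ∃ p, P.graph.Adj p x
    · simp only [par, h, dif_pos, Option.some.injEq]
      exact ⟨fun hp => hG.adj_unique h.choose_spec hp, fun e => e ▸ h.choose_spec⟩
    · simp only [par, h, dif_neg, not_false_eq_true, reduceCtorEq, iff_false]
      exact fun hp => h ⟨p, hp⟩
  choose only honly using fun l => Finset.card_eq_one.1 (hC.2 l)
  have hsurj : Function.Surjective only := fun x => by
    obtain ⟨l, hl⟩ := P.covered x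
    rw [honly l, Finset.mem_singleton] at hl
    exact ⟨l, hl.symm⟩
  have hbij : Function.Bijective only :=
    (Fintype.bijective_iff_surjective_and_card only).2 ⟨hsurj, hC.1⟩
  let e := Equiv.ofBijective only hbij
  refine ⟨par, depth, e.symm, hpar, fun p x h => hd p x ((hpar p x).2 h), hlt, fun x l => ?_,
    e.symm.injective, hT, hC.1⟩
  rw [honly l, Finset.mem_singleton, Equiv.eq_symm_apply]
  exact eq_comm

variable {P : Problem V W} {par : V → Option V} {depth : V → ℕ} {phys : V → W}

theorem Problem.activeAt_mono (P : Problem V W) (S : Finset V) (H : Finset W) :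
    Monotone (P.activeAt S H) :=
  monotone_nat_of_le_succ fun t x hx => by
    simp [Problem.activeAt, hx]

theorem Problem.Rooted.mem_activeAt_zero (h : P.Rooted par depth phys) {S : Finset V}
    {H : Finset W} {x : V} : x ∈ P.activeAt S H 0 ↔ x ∈ S ∧ phys x ∈ H := by
  simp [Problem.activeAt, h.mem_cover]

theorem Problem.Rooted.mem_activeAt_succ (h : P.Rooted par depth phys) {S : Finset V}
    {H : Finset W} {x : V} {t : ℕ} : x ∈ P.activeAt S H (t + 1) ↔
      x ∈ P.activeAt S H t ∨ (phys x ∈ H ∧ ∃ p ∈ P.activeAt S H t, par x = some p) := by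
  simp [Problem.activeAt, h.mem_cover, h.threshold_eq, Finset.one_le_card, Finset.Nonempty, h.adj_iff]

/-- Every set that is supported by the seeds and open physical nodes gets activated. -/
theorem Problem.Rooted.subset_activeAt (h : P.Rooted par depth phys) {S A : Finset V}
    {H : Finset W}
    (hA : ∀ x ∈ A, phys x ∈ H ∧ (x ∈ S ∨ ∃ p ∈ A, par x = some p)) :
    A ⊆ P.activeAt S H (Fintype.card V) := by
  -- Support travels one edge per time step, so a member at depth d is active by time d, and depths
  -- are less than N.
  have key : ∀ d x, depth x = d → x ∈ A → x ∈ P.activeAt S H d := by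
    intro d
    induction d with
    | zero =>
        intro x hd hx
        obtain ⟨hH, hS | ⟨p, -, hp⟩⟩ := hA x hx
        · exact h.mem_activeAt_zero.2 ⟨hS, hH⟩
        · have := h.depth_eq p x hp; omega
    | succ d ih =>
        intro x hd hx
        obtain ⟨hH, hS | ⟨p, hpA, hp⟩⟩ := hA x hx
        · exact P.activeAt_mono S H (Nat.zero_le _) (h.mem_activeAt_zero.2 ⟨hS, hH⟩)
        · refine h.mem_activeAt_succ.2 (Or.inr ⟨hH, p, ih p ?_ hpA, hp⟩)
          have := h.depth_eq p x hp; omega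
  exact fun x hx => P.activeAt_mono S H (h.depth_lt x).le (key _ x rfl hx)

/-- The converse of `subset_activeAt`: an active set needs an open physical node for each member and
a seed for each head. -/
theorem Problem.Rooted.supported_activeAt (h : P.Rooted par depth phys) {S : Finset V}
    {H : Finset W} {t : ℕ} {x : V} (hx : x ∈ P.activeAt S H t) :
    phys x ∈ H ∧ (x ∈ S ∨ ∃ p ∈ P.activeAt S H t, par x = some p) := by
  induction t with
  | zero => exact ⟨(h.mem_activeAt_zero.1 hx).2, Or.inl (h.mem_activeAt_zero.1 hx).1⟩
  | succ t ih =>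
      have hm := P.activeAt_mono S H (Nat.le_succ t)
      rcases h.mem_activeAt_succ.1 hx with hx | ⟨hH, p, hp, e⟩
      · obtain ⟨hH, hS | ⟨p, hp, e⟩⟩ := ih hx
        · exact ⟨hH, Or.inl hS⟩
        · exact ⟨hH, Or.inr ⟨p, hm hp, e⟩⟩
      · exact ⟨hH, Or.inr ⟨p, hm hp, e⟩⟩

theorem Input.Describes.coverers_eq {I : Input V W} (hI : I.Describes P)
    (h : P.Rooted par depth phys) (x : V) : I.coverers x = [phys x] := by
  refine List.perm_singleton.1 ((List.perm_ext_iff_of_nodup (hI.coverers_nodup x) (by simp)).2 ?_)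
  intro l
  simp [hI.mem_coverers, h.mem_cover]

theorem Input.Describes.length_nodes {I : Input V W} (hI : I.Describes P) :
    I.nodes.length = Fintype.card V := by
  classical
  rw [← List.toFinset_card_of_nodup hI.nodes_nodup, ← Finset.card_univ]
  congr 1
  ext x
  simp [hI.mem_nodes]

theorem Input.Describes.length_out {I : Input V W} (hI : I.Describes P) (x : V) :
    (I.out x).length ≤ Fintype.card V := by
  classical
  rw [← List.toFinset_card_of_nodup (hI.out_nodup x)]
  exact Finset.card_le_univ _

end Rooted

/-! ## Networks under construction -/

section Networks

variable {V : Type}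

/-- The nearest social node at or above a node; `own` gives it for dummy nodes. -/
def ownerOf (own : ℕ → Option V) : Node V → Option V
  | Sum.inl x => some x
  | Sum.inr d => own d

/-- The nearest social node strictly above a node. -/
def predOf (par : V → Option V) (own : ℕ → Option V) : Node V → Option V
  | Sum.inl x => par x
  | Sum.inr d => own d

def Net.HasPred (net : Net V) (u : Node V) : Prop := ∃ v, u ∈ net.out v

/-- The network is a forest that contracts to the forest with parent function `par` when dummy
nodes `d` are merged into their owners `own d`. -/
structure NetInv (par : V → Option V) (own : ℕ → Option V) (net : Net V) : Prop where
  nodup : net.nodes.Nodup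
  social_mem : ∀ x, Sum.inl x ∈ net.nodes
  dummy_mem : ∀ d, Sum.inr d ∈ net.nodes ↔ d < net.dummies
  out_nodup : ∀ v, (net.out v).Nodup
  out_mem : ∀ v u, u ∈ net.out v → v ∈ net.nodes ∧ u ∈ net.nodes
  unique : ∀ v v' u, u ∈ net.out v → u ∈ net.out v' → v = v'
  owner_eq : ∀ v u, u ∈ net.out v → predOf par own u = ownerOf own v
  dummy_lt : ∀ d d', Sum.inr d' ∈ net.out (Sum.inr d) → d < d'

variable {par : V → Option V} {own : ℕ → Option V} {net : Net V}

theorem NetInv.out_eq_nil (h : NetInv par own net) {v : Node V} (hv : v ∉ net.nodes) :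
    net.out v = [] :=
  List.eq_nil_iff_forall_not_mem.2 fun u hu => hv (h.out_mem v u hu).1

theorem ownerOf_congr {own own' : ℕ → Option V} {v : Node V}
    (h : ∀ d, v = Sum.inr d → own' d = own d) : ownerOf own' v = ownerOf own v := by
  cases v with
  | inl x => rfl
  | inr d => exact h d rfl

/-- Owners of dummies that do not exist yet are irrelevant. Hence `own` can be extended whenever a
dummy is constructed. -/
theorem NetInv.own_congr (h : NetInv par own net) {own' : ℕ → Option V}
    (ho : ∀ d < net.dummies, own' d = own d) : NetInv par own' net := by
  refine { h with owner_eq := fun v u hu => ?_ }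
  have hm := h.out_mem v u hu
  have e := h.owner_eq v u hu
  rw [ownerOf_congr fun d hd => ho d ((h.dummy_mem d).1 (hd ▸ hm.1)), ← e]
  cases u with
  | inl x => rfl
  | inr d => exact ho d ((h.dummy_mem d).1 hm.2)

variable [DecidableEq V]

def Net.withOut (net : Net V) (j : Node V) (L : List (Node V)) : Net V :=
  { net with out := Function.update net.out j L }

def Net.withDummy (net : Net V) : Net V :=
  { nodes := Sum.inr net.dummies :: net.nodes
    out := Function.update net.out (Sum.inr net.dummies) []
    dummies := net.dummies + 1 }

theorem Net.within_setOut {j : Node V} {L : List (Node V)} {B : ℕ} {Q : Net V → Prop}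
    (h : Q (net.withOut j L)) (hB : 1 ≤ B) : (net.setOut j L).Within B Q :=
  Prog.within_step h hB

theorem Net.within_addEdge {j m : Node V} {B : ℕ} {Q : Net V → Prop}
    (h : Q (net.withOut j (m :: net.out j))) (hB : 2 ≤ B) : (net.addEdge j m).Within B Q :=
  Prog.within_step_bind (by omega) (Net.within_setOut h (by omega))

theorem Net.within_addDummy {B : ℕ} {Q : Node V × Net V → Prop}
    (h : Q (Sum.inr net.dummies, net.withDummy)) (hB : 4 ≤ B) : net.addDummy.Within B Q := by
  refine Prog.within_step_bind (by omega) (Prog.within_step_bind (by omega) ?_)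
  refine Prog.Within.bind_le 1 (by omega)
    (Net.within_setOut (Q := fun n => n = net.withDummy) rfl le_rfl) ?_
  rintro _ rfl
  exact Prog.within_step h (by omega)

/-- A dummy index not yet in use already has an empty adjacency list, so clearing it changes
nothing. -/
theorem NetInv.withDummy_out (h : NetInv par own net) : net.withDummy.out = net.out := by
  have e : net.out (Sum.inr net.dummies) = [] :=
    h.out_eq_nil fun hm => lt_irrefl _ ((h.dummy_mem _).1 hm)
  simp only [Net.withDummy]
  rw [← e, Function.update_eq_self]

theorem NetInv.withOut_nil (h : NetInv par own net) (j : Node V) :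
    NetInv par own (net.withOut j []) := by
  have sub : ∀ v u, u ∈ (net.withOut j []).out v → u ∈ net.out v := by
    intro v u hu
    by_cases hv : v = j
    · subst hv; simp [Net.withOut] at hu
    · simpa [Net.withOut, Function.update_of_ne hv] using hu
  refine ⟨h.nodup, h.social_mem, h.dummy_mem, fun v => ?_, fun v u hu => h.out_mem v u (sub v u hu),
    fun v v' u hu hu' => h.unique v v' u (sub v u hu) (sub v' u hu'),
    fun v u hu => h.owner_eq v u (sub v u hu), fun d d' hd => h.dummy_lt d d' (sub _ _ hd)⟩
  by_cases hv : v = j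
  · subst hv; simp [Net.withOut]
  · simpa [Net.withOut, Function.update_of_ne hv] using h.out_nodup v

theorem Net.mem_withOut_cons {j m u v : Node V} :
    u ∈ (net.withOut j (m :: net.out j)).out v ↔ (v = j ∧ u = m) ∨ u ∈ net.out v := by
  by_cases hv : v = j
  · subst hv; simp [Net.withOut]
  · simp [Net.withOut, hv]

theorem Net.hasPred_withOut_cons {j m u : Node V} :
    (net.withOut j (m :: net.out j)).HasPred u ↔ u = m ∨ net.HasPred u := by
  simp only [Net.HasPred, Net.mem_withOut_cons]
  constructor
  · rintro ⟨v, ⟨-, h⟩ | h⟩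
    exacts [Or.inl h, Or.inr ⟨v, h⟩]
  · rintro (h | ⟨v, h⟩)
    exacts [⟨j, Or.inl ⟨rfl, h⟩⟩, ⟨v, Or.inr h⟩]

theorem NetInv.withOut_cons (h : NetInv par own net) {j m : Node V} (hj : j ∈ net.nodes)
    (hm : m ∈ net.nodes) (hp : ¬ net.HasPred m) (ho : predOf par own m = ownerOf own j)
    (hd : ∀ d d', j = Sum.inr d → m = Sum.inr d' → d < d') :
    NetInv par own (net.withOut j (m :: net.out j)) := by
  refine ⟨h.nodup, h.social_mem, h.dummy_mem, fun v => ?_, fun v u hu => ?_,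
    fun v v' u hu hu' => ?_, fun v u hu => ?_, fun d d' hu => ?_⟩
  · by_cases hv : v = j
    · subst hv
      simp only [Net.withOut, Function.update_self]
      exact List.nodup_cons.2 ⟨fun hm => hp ⟨v, hm⟩, h.out_nodup v⟩
    · simpa [Net.withOut, Function.update_of_ne hv] using h.out_nodup v
  · rcases Net.mem_withOut_cons.1 hu with ⟨rfl, rfl⟩ | hu
    exacts [⟨hj, hm⟩, h.out_mem v u hu]
  · rcases Net.mem_withOut_cons.1 hu with ⟨rfl, rfl⟩ | hu <;>
      rcases Net.mem_withOut_cons.1 hu' with ⟨e, e'⟩ | hu'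
    · exact e.symm
    · exact absurd ⟨v', hu'⟩ hp
    · exact absurd ⟨v, e' ▸ hu⟩ hp
    · exact h.unique v v' u hu hu'
  · rcases Net.mem_withOut_cons.1 hu with ⟨rfl, rfl⟩ | hu
    exacts [ho, h.owner_eq v u hu]
  · rcases Net.mem_withOut_cons.1 hu with ⟨e, e'⟩ | hu
    exacts [hd d d' e.symm e'.symm, h.dummy_lt d d' hu]

theorem NetInv.withDummy (h : NetInv par own net) : NetInv par own net.withDummy := by
  have e := h.withDummy_out
  refine ⟨?_, fun x => List.mem_cons_of_mem _ (h.social_mem x), fun d => ?_, ?_, ?_, ?_, ?_, ?_⟩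
  · exact List.nodup_cons.2 ⟨fun hm => lt_irrefl _ ((h.dummy_mem _).1 hm), h.nodup⟩
  · simp only [Net.withDummy, List.mem_cons, Sum.inr.injEq, h.dummy_mem]; omega
  · rw [e]; exact h.out_nodup
  · rw [e]
    exact fun v u hu => ⟨List.mem_cons_of_mem _ (h.out_mem v u hu).1,
      List.mem_cons_of_mem _ (h.out_mem v u hu).2⟩
  · rw [e]; exact h.unique
  · rw [e]; exact h.owner_eq
  · rw [e]; exact h.dummy_lt

/-- The effect of attaching `L` below `j`. -/
structure Attached (par : V → Option V) (own own' : ℕ → Option V) (net : Net V) (j : Node V)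
    (L : List (Node V)) (net' : Net V) : Prop where
  inv : NetInv par own' net'
  own_eq : ∀ d < net.dummies, own' d = own d
  dummies_le : net.dummies ≤ net'.dummies
  out_eq : ∀ v ∈ net.nodes, v ≠ j → net'.out v = net.out v
  length_out : (net'.out j).length = 2
  length_new : ∀ d, net.dummies ≤ d → d < net'.dummies →
    (net'.out (Sum.inr d)).length = 2 ∧ net'.HasPred (Sum.inr d)
  hasPred : ∀ m ∈ L, net'.HasPred m
  hasPred_old : ∀ u ∈ net.nodes, net'.HasPred u → u ∈ L ∨ net.HasPred u
  length_nodes : net'.nodes.length + 2 ≤ net.nodes.length + L.length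

/-- Every dummy of the chain receives the owner of `j`, so contracting the chain gives back edges
from that owner to all of `L`. Dummy indices grow along the chain, which keeps `dummy_lt` true. The
members of `L` are social, so no edge from the chain to `L` has to satisfy that condition. -/
theorem within_attach {x : ℕ} {j : Node V} {L : List (Node V)} (hx : 2 ≤ x) (hxL : L.length = x)
    (hN : L.Nodup) (h : NetInv par own net) (hj : j ∈ net.nodes) (hj0 : net.out j = [])
    (hL : ∀ m ∈ L, ∃ y, m = Sum.inl y ∧ par y = ownerOf own j ∧ ¬ net.HasPred m) {B : ℕ}
    (hB : x * (x + 12) ≤ B) :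
    (attach x j L net).Within B fun net' => ∃ own', Attached par own own' net j L net' := by
  induction x using Nat.strong_induction_on generalizing j L own net B with
  | _ x ih =>
  match x, hx with
  | 2, _ =>
      obtain ⟨m₁, m₂, rfl⟩ := List.length_eq_two.1 hxL
      obtain ⟨y₁, e₁, o₁, p₁⟩ := hL m₁ (by simp)
      obtain ⟨y₂, e₂, o₂, p₂⟩ := hL m₂ (by simp)
      have hne : m₂ ≠ m₁ := by
        rintro rfl; simp at hN
      have h₁ := h.withOut_cons hj (e₁ ▸ h.social_mem y₁) p₁ (e₁ ▸ o₁) (by rintro d d' - rfl; cases e₁)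
      have h₂ := h₁.withOut_cons (m := m₂) hj (e₂ ▸ h.social_mem y₂)
        (by rw [Net.hasPred_withOut_cons]; exact not_or.2 ⟨hne, p₂⟩) (e₂ ▸ o₂)
        (by rintro d d' - rfl; cases e₂)
      refine Prog.within_step_bind (by omega) ?_
      refine Prog.Within.bind_le 2 (by omega)
        (Net.within_addEdge (Q := fun n => n = net.withOut j (m₁ :: net.out j)) rfl le_rfl) ?_
      rintro _ rfl
      refine Prog.within_step_bind (by omega) ?_
      refine Prog.Within.bind_le 2 (by omega) (Net.within_addEdge (Q := fun n => n = _) rfl le_rfl) ?_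
      rintro _ rfl
      refine Prog.within_step ⟨own, h₂, fun _ _ => rfl, le_rfl, fun v _ hv => ?_, ?_,
        fun d h₁ h₂ => absurd h₂ (not_lt.2 h₁), fun m hm => ?_, fun u _ hu => ?_, le_rfl⟩ (by omega)
      · simp [Net.withOut, hv]
      · simp [Net.withOut, hj0]
      · simp only [Net.hasPred_withOut_cons]
        simp only [List.mem_cons, List.not_mem_nil, or_false] at hm
        tauto
      · simp only [Net.hasPred_withOut_cons] at hu
        simp only [List.mem_cons, List.not_mem_nil, or_false]
        tauto
  | x + 3, _ =>
      -- One round costs at most x + 12 steps (selecting from x + 3 nodes, two edges, one dummy),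
      -- less than this difference of consecutive bounds.
      have hmul : (x + 3) * (x + 3 + 12) = (x + 2) * (x + 2 + 12) + (2 * x + 17) := by ring
      refine Prog.Within.bind_le (L.length + 1) (by omega)
        (Prog.within_pickOut (by rintro rfl; simp at hxL) le_rfl) ?_
      rintro ⟨m, L'⟩ hp
      have hN' := hp.nodup_iff.1 hN
      have hlen : L'.length = x + 2 := by
        have := hp.length_eq
        simp only [List.length_cons] at this; omega
      have hmem : ∀ u, u ∈ L ↔ u = m ∨ u ∈ L' := fun u => by rw [hp.mem_iff, List.mem_cons]
      obtain ⟨y, e, o, p⟩ := hL m ((hmem m).2 (Or.inl rfl))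
      have hdj : j ≠ Sum.inr net.dummies := by
        rintro rfl; exact lt_irrefl _ ((h.dummy_mem _).1 hj)
      have h₁ := h.withOut_cons hj (e ▸ h.social_mem y) p (e ▸ o) (by rintro d d' - rfl; cases e)
      set net₁ := net.withOut j (m :: net.out j) with hnet₁
      have hd₁ : net₁.dummies = net.dummies := rfl
      let own₁ := Function.update own net.dummies (ownerOf own j)
      have hown : ∀ d < net.dummies, own₁ d = own d := fun d hd => by
        simp [own₁, Function.update_of_ne hd.ne]
      have hoj : ownerOf own₁ j = ownerOf own j :=
        ownerOf_congr fun d hd => hown d ((h.dummy_mem d).1 (hd ▸ hj))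
      have h₂ := (h₁.own_congr hown).withDummy
      have out₂ := h₁.withDummy_out
      set net₂ := net₁.withDummy with hnet₂
      have hpd : ¬ net₂.HasPred (Sum.inr net.dummies) := by
        rintro ⟨v, hv⟩
        rw [out₂] at hv
        exact lt_irrefl _ ((h₁.dummy_mem _).1 (h₁.out_mem _ _ hv).2)
      have h₃ := h₂.withOut_cons (j := j) (m := Sum.inr net.dummies) (List.mem_cons_of_mem _ hj)
        List.mem_cons_self hpd (by simp [predOf, hoj, own₁]) (by
          rintro d d' rfl e
          cases e
          exact (h.dummy_mem d).1 hj)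
      have hP₂ : ∀ u, net₂.HasPred u ↔ u = m ∨ net.HasPred u := fun u => by
        rw [← Net.hasPred_withOut_cons (j := j), Net.HasPred, out₂]; rfl
      have hP₃ : ∀ u, (net₂.withOut j (Sum.inr net.dummies :: net₂.out j)).HasPred u ↔
          u = Sum.inr net.dummies ∨ u = m ∨ net.HasPred u := fun u => by
        rw [Net.hasPred_withOut_cons, hP₂]
      have hout₃ : ∀ v, v ≠ j →
          (net₂.withOut j (Sum.inr net.dummies :: net₂.out j)).out v = net.out v := fun v hv => by
        simp [Net.withOut, Function.update_of_ne hv, out₂, net₁]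
      have hoj₃ : (net₂.withOut j (Sum.inr net.dummies :: net₂.out j)).out j =
          [Sum.inr net.dummies, m] := by
        simp [Net.withOut, out₂, net₁, hj0]
      refine Prog.Within.bind_le 2 (by omega) (Net.within_addEdge (Q := fun n => n = net₁) rfl le_rfl) ?_
      rintro _ rfl
      refine Prog.Within.bind_le 4 (by omega)
        (Net.within_addDummy (Q := fun q => q = (Sum.inr net₁.dummies, net₂)) rfl le_rfl) ?_
      rintro _ rfl
      refine Prog.Within.bind_le 2 (by omega) (Net.within_addEdge
        (Q := fun n => n = net₂.withOut j (Sum.inr net.dummies :: net₂.out j)) rfl le_rfl) ?_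
      rintro _ rfl
      rw [hd₁]
      set net₃ := net₂.withOut j (Sum.inr net.dummies :: net₂.out j) with hnet₃
      have hd₃ : net₃.dummies = net.dummies + 1 := rfl
      have hn₃ : net₃.nodes = Sum.inr net.dummies :: net.nodes := rfl
      refine (ih (x + 2) (by omega) (L := L') (net := net₃) (own := own₁) (j := Sum.inr net.dummies)
        (by omega) hlen (List.nodup_cons.1 hN').2 h₃ List.mem_cons_self ?_ ?_
        (by omega)).mono le_rfl ?_
      · rw [hout₃ _ hdj.symm]
        exact h.out_eq_nil fun hm => lt_irrefl _ ((h.dummy_mem _).1 hm)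
      · intro m' hm'
        obtain ⟨y', e', o', p'⟩ := hL m' ((hmem m').2 (Or.inr hm'))
        refine ⟨y', e', by simp [ownerOf, own₁, o'], ?_⟩
        rw [hP₃]
        rintro (h | rfl | h)
        · rw [e'] at h; cases h
        · exact (List.nodup_cons.1 hN').1 hm'
        · exact p' h
      · rintro net' ⟨own', A⟩
        have outj : net'.out j = [Sum.inr net.dummies, m] := by
          rw [A.out_eq j (List.mem_cons_of_mem _ hj) hdj, hoj₃]
        refine ⟨own', A.inv, fun d hd => ?_, ?_, fun v hv hvj => ?_, ?_, fun d hd hd' => ?_,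
          fun u hu => ?_, fun u hu hpu => ?_, ?_⟩
        · rw [A.own_eq d (by omega), hown d hd]
        · have := A.dummies_le; omega
        · rw [A.out_eq v (List.mem_cons_of_mem _ hv) ?_, hout₃ v hvj]
          rintro rfl
          exact lt_irrefl _ ((h.dummy_mem _).1 hv)
        · rw [outj]; rfl
        · rcases eq_or_lt_of_le hd with rfl | hd
          · exact ⟨A.length_out, j, by simp [outj]⟩
          · exact A.length_new d (by omega) hd'
        · rcases (hmem u).1 hu with rfl | hu
          · exact ⟨j, by simp [outj]⟩
          · exact A.hasPred u hu
        · rw [hmem]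
          rcases A.hasPred_old u (List.mem_cons_of_mem _ hu) hpu with h' | h'
          · exact Or.inl (Or.inr h')
          · rw [hP₃] at h'
            rcases h' with rfl | rfl | h'
            · exact absurd ((h.dummy_mem _).1 hu) (lt_irrefl _)
            · exact Or.inl (Or.inl rfl)
            · exact Or.inr h'
        · have := A.length_nodes
          simp only [hn₃, List.length_cons] at this
          omega

end Networks

/-! ### Acyclicity of the networks, and finding their roots -/

section Order

variable {V : Type} {par : V → Option V} {own : ℕ → Option V} {net : Net V} {depth : V → ℕ}

/-- A rank that increases along the edges of a network under construction. -/
def rank (depth : V → ℕ) (own : ℕ → Option V) : Node V → ℕ ×ₗ ℕ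
  | Sum.inl x => toLex (depth x + 1, 0)
  | Sum.inr d => toLex ((own d).elim 0 fun x => depth x + 1, d + 1)

/-- An edge into a social node increases the depth of the owner, the value 0 standing for no owner.
An edge into a dummy keeps the owner, and the second component increases: it is 0 for social nodes
and grows with the index of a dummy. -/
theorem NetInv.rank_lt (h : NetInv par own net)
    (hdep : ∀ p x, par x = some p → depth x = depth p + 1) {v u : Node V} (hu : u ∈ net.out v) :
    rank depth own v < rank depth own u := by
  have ho := h.owner_eq v u hu
  simp only [rank]
  cases v with
  | inl x =>
      cases u with
      | inl y =>
          have := hdep x y ho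
          exact Prod.Lex.toLex_lt_toLex.2 (Or.inl (by simp only; omega))
      | inr d =>
          have ho : own d = some x := ho
          exact Prod.Lex.toLex_lt_toLex.2 (Or.inr (by simp [ho]))
  | inr d =>
      cases u with
      | inl y =>
          have ho : par y = own d := ho
          refine Prod.Lex.toLex_lt_toLex.2 (Or.inl ?_)
          cases e : own d with
          | none => simp
          | some p => have := hdep p y (ho.trans e); simp only [Option.elim_some]; omega
      | inr d' =>
          have ho : own d' = own d := ho
          have := h.dummy_lt d d' hu
          exact Prod.Lex.toLex_lt_toLex.2 (Or.inr (by simp only [ho, true_and]; omega))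

theorem NetInv.exists_root (h : NetInv par own net)
    (hdep : ∀ p x, par x = some p → depth x = depth p + 1) [Nonempty V] :
    ∃ r ∈ net.nodes, ¬ net.HasPred r := by
  classical
  obtain ⟨r, hr, hmin⟩ := net.nodes.toFinset.exists_min_image (rank depth own)
    ⟨Sum.inl (Classical.arbitrary V), by simpa using h.social_mem _⟩
  refine ⟨r, List.mem_toFinset.1 hr, fun ⟨v, hv⟩ => ?_⟩
  exact absurd (hmin v (List.mem_toFinset.2 (h.out_mem v r hv).1)) (not_le.2 (h.rank_lt hdep hv))

theorem NetInv.length_out_le (h : NetInv par own net) (v : Node V) :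
    (net.out v).length ≤ net.nodes.length :=
  ((h.out_nodup v).subperm fun u hu => (h.out_mem v u hu).2).length_le

theorem length_le_card_of_social [Fintype V] {L : List (Node V)} (hN : L.Nodup)
    (hL : ∀ u ∈ L, ∃ y, u = Sum.inl y) : L.length ≤ Fintype.card V := by
  have : L.Subperm (Finset.univ.toList.map (Sum.inl : V → Node V)) :=
    hN.subperm fun u hu => by
      obtain ⟨y, rfl⟩ := hL u hu
      simp
  simpa using this.length_le

theorem within_findRoots [DecidableEq V] {Z : ℕ} (h : NetInv par own net) (hZ : net.nodes.length ≤ Z) {B : ℕ}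
    (hB : 2 * (Z * Z) + 4 * Z + 2 ≤ B) :
    (findRoots net).Within B fun L =>
      L.Nodup ∧ ∀ u, u ∈ L ↔ u ∈ net.nodes ∧ ¬ net.HasPred u := by
  have h1 : net.nodes.length * (2 * Z + 1 + 1) + 1 ≤ 2 * (Z * Z) + 2 * Z + 1 := by
    have := Nat.mul_le_mul_right (2 * Z + 1 + 1) hZ
    have e : Z * (2 * Z + 1 + 1) = 2 * (Z * Z) + 2 * Z := by ring
    omega
  refine Prog.Within.bind_le (2 * (Z * Z) + 2 * Z + 1) (by omega)
    -- Invariant: the nodes already marked together with the outgoing neighbours of the nodes still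
    -- to be scanned are all nodes that have a predecessor.
    (Prog.within_forList (b := 2 * Z + 1) (fun vs mark =>
      ∀ u, (mark u = true ∨ ∃ v ∈ vs, u ∈ net.out v) ↔ ∃ v ∈ net.nodes, u ∈ net.out v)
      (by simp) ?_ h1) ?_
  · intro v vs mark _ hm
    have h2 : (net.out v).length * (1 + 1) + 1 ≤ 2 * Z + 1 := by
      have := h.length_out_le v
      omega
    refine (Prog.within_forList (b := 1) (fun us (mark' : Node V → Bool) =>
      ∀ u, (mark' u = true ∨ u ∈ us) ↔ (mark u = true ∨ u ∈ net.out v))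
      (by simp) ?_ h2).mono le_rfl ?_
    · intro a as mark' _ ha
      refine Prog.within_step (fun u => ?_) le_rfl
      rw [← ha u]
      by_cases e : u = a
      · subst e; simp
      · simp [e]
    · intro mark' h' u
      rw [← hm u]
      have := h' u
      simp only [List.not_mem_nil, or_false] at this
      simp only [this, List.mem_cons, exists_eq_or_imp]
      tauto
  · intro mark hm
    simp only [List.not_mem_nil, false_and, exists_false, or_false] at hm
    refine (Prog.within_filterList (P := fun v => !mark v) (b := 1)
      (fun v _ => Prog.within_step rfl le_rfl) (by omega)).mono le_rfl ?_
    rintro _ rfl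
    refine ⟨h.nodup.filter _, fun u => ?_⟩
    have e : net.HasPred u ↔ ∃ v ∈ net.nodes, u ∈ net.out v :=
      ⟨fun ⟨v, hv⟩ => ⟨v, (h.out_mem v u hv).1, hv⟩, fun ⟨v, _, hv⟩ => ⟨v, hv⟩⟩
    rw [List.mem_filter, e, ← hm u]
    simp

end Order

/-! ### Construction of the binary tree -/

section Construction

variable {V W : Type} [Fintype V] {par : V → Option V} {own : ℕ → Option V}
  {net : Net V} {depth : V → ℕ}

/-- Invariant of the first phase: only social nodes can have more than two outgoing neighbours, and
these are still the original ones. -/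
structure Splitting (par : V → Option V) (own : ℕ → Option V) (net : Net V) : Prop where
  inv : NetInv par own net
  dummy_length : ∀ d < net.dummies, (net.out (Sum.inr d)).length = 2
  dummy_pred : ∀ d < net.dummies, net.HasPred (Sum.inr d)
  social_pred : ∀ x p, par x = some p → net.HasPred (Sum.inl x)
  social_out : ∀ x, 2 < (net.out (Sum.inl x)).length → ∀ u ∈ net.out (Sum.inl x), ∃ y, u = Sum.inl y

/-- The result of the construction: a tree with root `r` in which every node has at most two
outgoing neighbours. -/
structure IsTree (par : V → Option V) (own : ℕ → Option V) (net : Net V) (r : Node V) : Prop where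
  inv : NetInv par own net
  root_mem : r ∈ net.nodes
  root_no_pred : ¬ net.HasPred r
  root_predOf : predOf par own r = none
  hasPred : ∀ u ∈ net.nodes, u ≠ r → net.HasPred u
  length_out : ∀ v, (net.out v).length ≤ 2
  dummy_length : ∀ d < net.dummies, (net.out (Sum.inr d)).length = 2

/-- The social nodes that have more than two outgoing neighbours. -/
def Net.big (net : Net V) : Finset V :=
  Finset.univ.filter fun x => 2 < (net.out (Sum.inl x)).length

variable [DecidableEq V]

theorem within_initialNet [Fintype W] {I : Input V W} {P : Problem V W} {phys : V → W}
    (hI : I.Describes P) (hR : P.Rooted par depth phys) {B : ℕ}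
    (hB : Fintype.card V * (Fintype.card V + 2) + Fintype.card V + 3 ≤ B) :
    (initialNet I).Within B fun net =>
      Splitting par (fun _ => none) net ∧ net.nodes.length = Fintype.card V := by
  have hlen := hI.length_nodes
  replace hB : Fintype.card V * (Fintype.card V + 1 + 1) + Fintype.card V + 3 ≤ B := hB
  refine Prog.within_charge_bind (by omega) ?_
  refine Prog.Within.bind_le (I.nodes.length * (Fintype.card V + 1 + 1) + 1) (by rw [hlen]; omega)
    (Prog.within_forList (b := Fintype.card V + 1) (fun as out =>
      (∀ d, out (Sum.inr d) = []) ∧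
        ∀ x, x ∉ as → out (Sum.inl x) = (I.out x).map Sum.inl)
      ⟨fun _ => rfl, fun x hx => absurd (hI.mem_nodes x) hx⟩ ?_ le_rfl) ?_
  · intro v as out _ ⟨h₁, h₂⟩
    refine Prog.within_charge ⟨fun d => by simpa using h₁ d, fun x hx => ?_⟩
      (by have := hI.length_out v; omega)
    by_cases hv : x = v
    · subst hv; simp
    · rw [Function.update_of_ne (by simpa using hv)]
      exact h₂ x (by simp [hv, hx])
  · rintro out ⟨h₁, h₂⟩
    replace h₂ := fun x => h₂ x (by simp)
    refine Prog.within_step ⟨?_, by simpa using hlen⟩ (by rw [hlen]; omega)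
    have mem : ∀ v u, u ∈ out v ↔ ∃ x y, v = Sum.inl x ∧ u = Sum.inl y ∧ par y = some x := by
      intro v u
      cases v with
      | inl x =>
          rw [h₂, List.mem_map]
          simp only [hI.mem_out, hR.adj_iff, Sum.inl.injEq]
          constructor
          · rintro ⟨y, hy, rfl⟩; exact ⟨x, y, rfl, rfl, hy⟩
          · rintro ⟨_, y, rfl, rfl, hy⟩; exact ⟨y, hy, rfl⟩
      | inr d => simp [h₁]
    refine ⟨⟨?_, ?_, ?_, ?_, ?_, ?_, ?_, ?_⟩, ?_, ?_, ?_, ?_⟩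
    · exact hI.nodes_nodup.map Sum.inl_injective
    · exact fun x => List.mem_map.2 ⟨x, hI.mem_nodes x, rfl⟩
    · simp
    · intro v
      cases v with
      | inl x => simp only [h₂]; exact (hI.out_nodup x).map Sum.inl_injective
      | inr d => simp [h₁]
    · intro v u hu
      obtain ⟨x, y, rfl, rfl, -⟩ := (mem v u).1 hu
      exact ⟨List.mem_map.2 ⟨x, hI.mem_nodes x, rfl⟩, List.mem_map.2 ⟨y, hI.mem_nodes y, rfl⟩⟩
    · intro v v' u hu hu'
      obtain ⟨x, y, rfl, rfl, e⟩ := (mem v u).1 hu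
      obtain ⟨x', y', rfl, e₁, e'⟩ := (mem v' _).1 hu'
      cases e₁
      rw [e] at e'
      cases e'
      rfl
    · intro v u hu
      obtain ⟨x, y, rfl, rfl, e⟩ := (mem v u).1 hu
      exact e
    · intro d d' hd; simp [h₁] at hd
    · intro d hd; simp at hd
    · intro d hd; simp at hd
    · exact fun x p hp => ⟨Sum.inl p, (mem _ _).2 ⟨p, x, rfl, rfl, hp⟩⟩
    · intro x _ u hu
      obtain ⟨_, y, -, rfl, -⟩ := (mem _ u).1 hu
      exact ⟨y, rfl⟩

/-- Each pass removes one node from `net.big` and creates fewer than |V| dummies. So the size of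
`net.big` bounds the number of passes, and the number of nodes plus |V| times that size never
increases. -/
theorem within_binarize {n Z : ℕ} (hZ : Fintype.card V ≤ Z) (h : Splitting par own net)
    (hn : net.big.card < n) (hc : net.nodes.length + Fintype.card V * net.big.card ≤ Z) {B : ℕ}
    (hB : n * (2 * (Z * Z) + 20 * Z + 10) ≤ B) :
    (binarize n net).Within B fun net' => ∃ own', Splitting par own' net' ∧
      (∀ v, (net'.out v).length ≤ 2) ∧ net'.nodes.length ≤ Z := by
  induction n generalizing net own B with
  | zero => omega
  | succ n ih =>
      rw [add_mul, one_mul] at hB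
      have hnZ : net.nodes.length ≤ Z := by omega
      have hfil : net.nodes.length * (Z + 1 + 1) + 1 ≤ Z * Z + 2 * Z + 1 := by
        have := Nat.mul_le_mul_right (Z + 1 + 1) hnZ
        have e : Z * (Z + 1 + 1) = Z * Z + 2 * Z := by ring
        omega
      refine Prog.Within.bind_le (Z * Z + 2 * Z + 1) (by omega)
        (Prog.within_filterList (P := fun v => decide (2 < (net.out v).length)) (b := Z + 1)
          (fun v _ => Prog.within_charge rfl
            (by have := h.inv.length_out_le v; omega)) hfil) ?_
      rintro bigs hbigs
      have hbm : ∀ v, v ∈ bigs ↔ v ∈ net.nodes ∧ 2 < (net.out v).length := by simp [hbigs]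
      have hbl : bigs.length ≤ Z := hbigs ▸ (List.length_filter_le _ _).trans hnZ
      clear hbigs
      match bigs with
      | [] =>
          refine Prog.within_step ⟨own, h, fun v => ?_, hnZ⟩ (by omega)
          by_contra hv
          by_cases hm : v ∈ net.nodes
          · exact absurd ((hbm v).2 ⟨hm, by omega⟩) (by simp)
          · simp [h.inv.out_eq_nil hm] at hv
      | b :: bs =>
          refine Prog.Within.bind_le (Z + 1) (by omega)
            (Prog.within_pickOut (by simp) (by omega)) ?_
          rintro ⟨v, rest⟩ hp
          obtain ⟨hv, hv2⟩ := (hbm v).1 (hp.symm.subset (by simp))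
          -- Dummies have exactly two outgoing neighbours, so only social nodes are ever selected.
          -- Their lists are still untouched and thus purely social, as `within_attach` requires.
          obtain ⟨x, rfl⟩ : ∃ x, v = Sum.inl x := by
            cases v with
            | inl x => exact ⟨x, rfl⟩
            | inr d =>
                have := h.dummy_length d ((h.inv.dummy_mem d).1 hv)
                omega
          have hsoc := h.social_out x hv2
          have hLN := length_le_card_of_social (h.inv.out_nodup _) hsoc
          dsimp only
          refine Prog.within_step_bind (by omega) (Prog.within_charge_bind (by omega) ?_)
          refine Prog.Within.bind_le 1 (by omega) (Net.within_setOut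
            (Q := fun m => m = net.withOut (Sum.inl x) []) rfl le_rfl) ?_
          rintro _ rfl
          have hN : NetInv par own (net.withOut (Sum.inl x) []) := h.inv.withOut_nil _
          have hatt : (net.out (Sum.inl x)).length * ((net.out (Sum.inl x)).length + 12) ≤
              Z * Z + 12 * Z := by
            have := Nat.mul_le_mul (hLN.trans hZ) (Nat.add_le_add_right (hLN.trans hZ) 12)
            have e : Z * (Z + 12) = Z * Z + 12 * Z := by ring
            omega
          refine Prog.Within.bind_le (Z * Z + 12 * Z) (by omega)
            (within_attach (by omega) rfl (h.inv.out_nodup _) hN hv (by simp [Net.withOut]) ?_ hatt) ?_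
          · intro m hm
            obtain ⟨y, rfl⟩ := hsoc m hm
            refine ⟨y, rfl, h.inv.owner_eq _ _ hm, ?_⟩
            rintro ⟨v, hv⟩
            by_cases e : v = Sum.inl x
            · subst e; simp [Net.withOut] at hv
            · simp only [Net.withOut, Function.update_of_ne e] at hv
              exact e (h.inv.unique _ _ _ hv hm)
          · rintro net' ⟨own', A⟩
            have out' : ∀ v ∈ net.nodes, v ≠ Sum.inl x → net'.out v = net.out v := fun v hv hvx => by
              rw [A.out_eq v hv hvx]; simp [Net.withOut, Function.update_of_ne hvx]
            have keep : ∀ u, net.HasPred u → net'.HasPred u := by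
              rintro u ⟨v, hu⟩
              by_cases e : v = Sum.inl x
              · subst e; exact A.hasPred u hu
              · exact ⟨v, by rwa [out' v (h.inv.out_mem v u hu).1 e]⟩
            have hd : (net.withOut (Sum.inl x) []).dummies = net.dummies := rfl
            have hS : Splitting par own' net' := by
              refine ⟨A.inv, fun d hd' => ?_, fun d hd' => ?_,
                fun y p hy => keep _ (h.social_pred y p hy), fun y hy u hu => ?_⟩
              · by_cases hlt : d < net.dummies
                · rw [out' _ ((h.inv.dummy_mem d).2 hlt) (by simp)]
                  exact h.dummy_length d hlt
                · exact (A.length_new d (not_lt.1 hlt) hd').1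
              · by_cases hlt : d < net.dummies
                · exact keep _ (h.dummy_pred d hlt)
                · exact (A.length_new d (not_lt.1 hlt) hd').2
              · by_cases e : y = x
                · subst e; have := A.length_out; omega
                · rw [out' _ (h.inv.social_mem y) (by simpa using e)] at hy hu
                  exact h.social_out y hy u hu
            have hbig : net'.big ⊆ net.big.erase x := by
              intro y hy
              have hy' : 2 < (net'.out (Sum.inl y)).length := by simpa [Net.big] using hy
              have e : y ≠ x := by
                rintro rfl
                have := A.length_out; omega
              rw [out' _ (h.inv.social_mem y) (by simpa using e)] at hy'
              simp [Net.big, e, hy']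
            have hx : x ∈ net.big := by simpa [Net.big] using hv2
            have hcard := Finset.card_le_card hbig
            rw [Finset.card_erase_of_mem hx] at hcard
            have hpos := Finset.card_pos.2 ⟨x, hx⟩
            have hlenn : net'.nodes.length + 2 ≤ net.nodes.length + (net.out (Sum.inl x)).length :=
              A.length_nodes
            have hmul := Nat.mul_le_mul_left (Fintype.card V)
              (show net'.big.card + 1 ≤ net.big.card by omega)
            rw [mul_add, mul_one] at hmul
            exact ih hS (by omega) (by omega) (by omega)

/-- Dummies have predecessors, so all roots found are social nodes without parent. The list of roots
is nonempty because a node of least rank is a root. Joining adds the new root and at most |V| - 2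
further dummies. -/
theorem within_joinTrees [Nonempty V] {Z : ℕ} (h : Splitting par own net)
    (hdep : ∀ p x, par x = some p → depth x = depth p + 1)
    (h2 : ∀ v, (net.out v).length ≤ 2) (hcZ : Fintype.card V ≤ Z) (hZ : net.nodes.length ≤ Z)
    {B : ℕ} (hB : 3 * (Z * Z) + 17 * Z + 10 ≤ B) :
    (joinTrees net).Within B fun q => ∃ own', IsTree par own' q.2 q.1 ∧
      q.2.nodes.length ≤ 2 * Z + 1 := by
  refine Prog.Within.bind_le (2 * (Z * Z) + 4 * Z + 2) (by omega)
    (within_findRoots h.inv hZ le_rfl) ?_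
  rintro roots ⟨hnd, hmem⟩
  have hroot : ∀ u ∈ roots, ∃ y, u = Sum.inl y ∧ par y = none ∧ ¬ net.HasPred u := by
    intro u hu
    obtain ⟨hn, hp⟩ := (hmem u).1 hu
    cases u with
    | inl y =>
        refine ⟨y, rfl, ?_, hp⟩
        cases e : par y with
        | none => rfl
        | some p => exact absurd (h.social_pred y p e) hp
    | inr d => exact absurd (h.dummy_pred d ((h.inv.dummy_mem d).1 hn)) hp
  have hlen := length_le_card_of_social hnd fun u hu => (hroot u hu).imp fun y hy => hy.1
  match roots with
  | [] =>
      obtain ⟨r, hr, hp⟩ := h.inv.exists_root hdep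
      exact absurd ((hmem r).2 ⟨hr, hp⟩) (by simp)
  | [r] =>
      refine Prog.within_step ⟨own, ⟨h.inv, ((hmem r).1 (by simp)).1, ((hmem r).1 (by simp)).2, ?_,
        fun u hu hur => ?_, h2, h.dummy_length⟩, by simp only; omega⟩ (by omega)
      · obtain ⟨y, rfl, hy, -⟩ := hroot r (by simp)
        exact hy
      · by_contra hp
        exact hur (by simpa using (hmem u).2 ⟨hu, hp⟩)
  | a :: b :: L =>
      refine Prog.Within.bind_le 4 (by omega)
        (Net.within_addDummy (Q := fun q => q = (Sum.inr net.dummies, net.withDummy)) rfl le_rfl) ?_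
      rintro _ rfl
      refine Prog.within_charge_bind (by omega) ?_
      -- The dummy root has no social node above it. `within_attach` passes this owner `none` on to
      -- the whole chain below it.
      let own₁ := Function.update own net.dummies none
      have hown : ∀ d < net.dummies, own₁ d = own d := fun d hd => by
        simp [own₁, Function.update_of_ne hd.ne]
      have h₁ := (h.inv.own_congr hown).withDummy
      have out₁ := h.inv.withDummy_out
      have hP₁ : ∀ u, net.withDummy.HasPred u ↔ net.HasPred u := fun u => by
        simp only [Net.HasPred, out₁]
      have hfresh : Sum.inr net.dummies ∉ net.nodes := fun hm =>
        lt_irrefl _ ((h.inv.dummy_mem _).1 hm)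
      have hatt : (a :: b :: L).length * ((a :: b :: L).length + 12) ≤ Z * Z + 12 * Z := by
        have := Nat.mul_le_mul (hlen.trans hcZ) (Nat.add_le_add_right (hlen.trans hcZ) 12)
        have e : Z * (Z + 12) = Z * Z + 12 * Z := by ring
        omega
      refine Prog.Within.bind_le (Z * Z + 12 * Z) (by omega)
        (within_attach (by simp) rfl hnd h₁ List.mem_cons_self
          (by rw [out₁]; exact h.inv.out_eq_nil hfresh) ?_ hatt) ?_
      · intro m hm
        obtain ⟨y, rfl, hy, hp⟩ := hroot m hm
        exact ⟨y, rfl, by simp [ownerOf, own₁, hy], by rwa [hP₁]⟩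
      · rintro net' ⟨own', A⟩
        have hd₁ : net.withDummy.dummies = net.dummies + 1 := rfl
        have hdl := A.dummies_le
        have hr : Sum.inr net.dummies ∈ net'.nodes := (A.inv.dummy_mem _).2 (by omega)
        have out' : ∀ v ∈ net.nodes, net'.out v = net.out v := fun v hv => by
          rw [A.out_eq v (List.mem_cons_of_mem _ hv) (by rintro rfl; exact hfresh hv), out₁]
        have keep : ∀ u, net.HasPred u → net'.HasPred u := by
          rintro u ⟨v, hu⟩
          exact ⟨v, by rwa [out' v (h.inv.out_mem v u hu).1]⟩
        have old : ∀ u ∈ net.nodes, net'.HasPred u := fun u hu => by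
          by_cases hp : net.HasPred u
          · exact keep u hp
          · exact A.hasPred u ((hmem u).2 ⟨hu, hp⟩)
        have hdl' : ∀ d < net'.dummies, (net'.out (Sum.inr d)).length = 2 := by
          intro d hd
          rcases lt_trichotomy d net.dummies with hlt | rfl | hgt
          · rw [out' _ ((h.inv.dummy_mem d).2 hlt)]; exact h.dummy_length d hlt
          · exact A.length_out
          · exact (A.length_new d (by omega) hd).1
        refine Prog.within_step ⟨own', ⟨A.inv, hr, fun hp => ?_, ?_, fun u hu hur => ?_, fun v => ?_,
          hdl'⟩, ?_⟩ (by simp only [List.length_cons] at *; omega)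
        · rcases A.hasPred_old _ List.mem_cons_self hp with hL | hp
          · obtain ⟨y, e, -⟩ := hroot _ hL
            cases e
          · obtain ⟨v, hv⟩ := (hP₁ _).1 hp
            exact hfresh (h.inv.out_mem _ _ hv).2
        · simp only [predOf]
          rw [A.own_eq _ (by omega)]
          simp [own₁]
        · cases u with
          | inl y => exact old _ (h.inv.social_mem y)
          | inr d =>
              rcases lt_trichotomy d net.dummies with hlt | rfl | hgt
              · exact old _ ((h.inv.dummy_mem d).2 hlt)
              · exact absurd rfl hur
              · exact (A.length_new d (by omega) ((A.inv.dummy_mem d).1 hu)).2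
        · by_cases hv : v ∈ net'.nodes
          · cases v with
            | inl y => rw [out' _ (h.inv.social_mem y)]; exact h2 _
            | inr d => exact (hdl' d ((A.inv.dummy_mem d).1 hv)).le
          · simp [A.inv.out_eq_nil hv]
        · have := A.length_nodes
          simp only [Net.withDummy, List.length_cons] at *
          omega

end Construction

/-! ## Descendants -/

section Descendants

open Relation

variable {V : Type} {par : V → Option V} {own : ℕ → Option V} {net : Net V} {depth : V → ℕ}
  {r : Node V}

theorem NetInv.rank_le_of_reach (h : NetInv par own net)
    (hdep : ∀ p x, par x = some p → depth x = depth p + 1) {v u : Node V}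
    (hu : ReflTransGen (fun a b => b ∈ net.out a) v u) : rank depth own v ≤ rank depth own u := by
  induction hu with
  | refl => exact le_rfl
  | tail _ hbc ih => exact ih.trans (h.rank_lt hdep hbc).le

/-- The owner of a node reached from `v` is the owner of `v` or is reached from `v`. -/
theorem NetInv.owner_reach (h : NetInv par own net) {v y : Node V}
    (hy : ReflTransGen (fun a b => b ∈ net.out a) v y) {p : V} (hp : ownerOf own y = some p) :
    ownerOf own v = some p ∨ ReflTransGen (fun a b => b ∈ net.out a) v (Sum.inl p) := by
  induction hy with
  | refl => exact Or.inl hp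
  | @tail y z hvy hyz ih =>
      cases z with
      | inl x =>
          cases hp
          exact Or.inr (hvy.tail hyz)
      | inr d => exact ih ((h.owner_eq _ _ hyz).symm.trans hp)

theorem IsTree.reach_root (h : IsTree par own net r)
    (hdep : ∀ p x, par x = some p → depth x = depth p + 1) {u : Node V} (hu : u ∈ net.nodes) :
    ReflTransGen (fun a b => b ∈ net.out a) r u := by
  induction hr : rank depth own u using WellFoundedLT.induction generalizing u with
  | _ m ih =>
      by_cases e : u = r
      · rw [e]
      · obtain ⟨v, hv⟩ := h.hasPred u hu e
        exact (ih _ (hr ▸ h.inv.rank_lt hdep hv) (h.inv.out_mem v u hv).1 rfl).tail hv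

variable [Fintype V]

open Classical in
/-- The social nodes that can be reached from a node. -/
noncomputable def Net.desc (net : Net V) (v : Node V) : Finset V :=
  Finset.univ.filter fun x => ReflTransGen (fun a b => b ∈ net.out a) v (Sum.inl x)

theorem Net.mem_desc {v : Node V} {x : V} :
    x ∈ net.desc v ↔ ReflTransGen (fun a b => b ∈ net.out a) v (Sum.inl x) := by
  simp [Net.desc]

theorem Net.mem_desc_iff {v : Node V} {x : V} :
    x ∈ net.desc v ↔ v = Sum.inl x ∨ ∃ u ∈ net.out v, x ∈ net.desc u := by
  simp only [Net.mem_desc]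
  rw [ReflTransGen.cases_head_iff]

theorem NetInv.not_mem_desc (h : NetInv par own net)
    (hdep : ∀ p x, par x = some p → depth x = depth p + 1) {x : V} {u : Node V}
    (hu : u ∈ net.out (Sum.inl x)) : x ∉ net.desc u := fun hx =>
  absurd (h.rank_le_of_reach hdep (Net.mem_desc.1 hx)) (not_le.2 (h.rank_lt hdep hu))

/-- Predecessors are unique, so two ancestors of a common node are comparable. If one child of v
reached another one, it would do so through v itself, against the rank. -/
theorem NetInv.desc_disjoint (h : NetInv par own net)
    (hdep : ∀ p x, par x = some p → depth x = depth p + 1) {v u₁ u₂ : Node V}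
    (h₁ : u₁ ∈ net.out v) (h₂ : u₂ ∈ net.out v) (hne : u₁ ≠ u₂) :
    Disjoint (net.desc u₁) (net.desc u₂) := by
  have key : ∀ {a b : Node V}, a ∈ net.out v → b ∈ net.out v → a ≠ b →
      ¬ ReflTransGen (fun a b => b ∈ net.out a) a b := by
    intro a b ha hb hab hr
    rcases ReflTransGen.cases_tail hr with e | ⟨c, hac, hcb⟩
    · exact hab e.symm
    · rw [h.unique c v b hcb hb] at hac
      exact absurd (h.rank_le_of_reach hdep hac) (not_le.2 (h.rank_lt hdep ha))
  rw [Finset.disjoint_left]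
  intro x hx₁ hx₂
  have t := ReflTransGen.total_of_right_unique (r := Function.swap fun a b => b ∈ net.out a)
    (fun a b c hb hc => h.unique b c a hb hc)
    (reflTransGen_swap.2 (Net.mem_desc.1 hx₁)) (reflTransGen_swap.2 (Net.mem_desc.1 hx₂))
  rcases t with t | t
  · exact key h₂ h₁ hne.symm (reflTransGen_swap.1 t)
  · exact key h₁ h₂ hne (reflTransGen_swap.1 t)

theorem IsTree.desc_root (h : IsTree par own net r)
    (hdep : ∀ p x, par x = some p → depth x = depth p + 1) : net.desc r = Finset.univ :=
  Finset.eq_univ_iff_forall.2 fun x => Net.mem_desc.2 (h.reach_root hdep (h.inv.social_mem x))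

end Descendants

/-! ## Stored solutions and the sets of active nodes that they compete with -/

section Solutions

variable {V W : Type}

/-- The social node `o`, if there is one, belongs to `A`. -/
def IsActive (A : Finset V) (o : Option V) : Prop := ∃ p ∈ A, o = some p

/-- The members of `A` that need a seed because their parents do not belong to `A`. -/
def heads [DecidableEq V] (par : V → Option V) (A : Finset V) : Finset V :=
  A.filter fun x => ∀ p ∈ A, par x ≠ some p

/-- The value of the stored solution is realized by a set of active nodes within `D`, provided that
the node `ctx`, if there is one, is active; and the solution respects the budgets `k` and `l`. -/
structure Sol.Sound (par : V → Option V) (phys : V → W) (w : V → ℝ) (D : Finset V)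
    (ctx : Option V) (k l : ℕ) (s : Sol V W) : Prop where
  seeds_le : s.seeds.card ≤ k
  opened_le : s.opened.card ≤ l
  active : ∃ A ⊆ D, s.val ≤ ∑ x ∈ A, w x ∧ ∀ x ∈ A, phys x ∈ s.opened ∧
    (x ∈ s.seeds ∨ ∃ p, par x = some p ∧ (p ∈ A ∨ ctx = some p))

/-- If the part of `A` in `D` respects the budgets `k` and `l`, then its weight is at most `c`. -/
def Dominated [DecidableEq V] (par : V → Option V) (w : V → ℝ) (A D : Finset V) (k l : ℕ) (c : ℝ) : Prop :=
  (heads par A ∩ D).card ≤ k → (A ∩ D).card ≤ l → ∑ x ∈ A ∩ D, w x ≤ c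

variable {par : V → Option V} {phys : V → W} {w : V → ℝ} {D D₁ D₂ A : Finset V}
  {ctx : Option V} {k k₁ k₂ l l₁ l₂ : ℕ} {s s₁ s₂ : Sol V W} {c c₁ c₂ : ℝ}

theorem heads_subset [DecidableEq V] : heads par A ⊆ A := Finset.filter_subset _ _

theorem mem_heads [DecidableEq V] {x : V} : x ∈ heads par A ↔ x ∈ A ∧ ¬ IsActive A (par x) := by
  simp [heads, IsActive]

theorem Sol.Sound.mono (h : s.Sound par phys w D₁ ctx k₁ l₁) (hD : D₁ ⊆ D₂) (hk : k₁ ≤ k₂)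
    (hl : l₁ ≤ l₂) : s.Sound par phys w D₂ ctx k₂ l₂ := by
  obtain ⟨A, hA, hv, hs⟩ := h.active
  exact ⟨h.seeds_le.trans hk, h.opened_le.trans hl, A, hA.trans hD, hv, hs⟩

theorem Sol.Sound.weaken (h : s.Sound par phys w D none k l) :
    s.Sound par phys w D ctx k l := by
  obtain ⟨A, hA, hv, hs⟩ := h.active
  refine ⟨h.seeds_le, h.opened_le, A, hA, hv, fun x hx => ⟨(hs x hx).1, (hs x hx).2.imp_right ?_⟩⟩
  rintro ⟨p, hp, hpA | e⟩
  exacts [⟨p, hp, Or.inl hpA⟩, nomatch e]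

theorem Sol.sound_zero : Sol.Sound par phys w D ctx k l ⟨0, ∅, ∅⟩ :=
  ⟨by simp, by simp, ∅, by simp, by simp, by simp⟩

variable [DecidableEq V]

theorem Sol.Sound.join [DecidableEq W] (h₁ : s₁.Sound par phys w D₁ ctx k₁ l₁)
    (h₂ : s₂.Sound par phys w D₂ ctx k₂ l₂) (hD : Disjoint D₁ D₂) :
    Sol.Sound par phys w (D₁ ∪ D₂) ctx (k₁ + k₂) (l₁ + l₂)
      ⟨s₁.val + s₂.val, s₁.seeds ∪ s₂.seeds, s₁.opened ∪ s₂.opened⟩ := by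
  obtain ⟨A₁, hA₁, hv₁, hs₁⟩ := h₁.active
  obtain ⟨A₂, hA₂, hv₂, hs₂⟩ := h₂.active
  refine ⟨(Finset.card_union_le _ _).trans (add_le_add h₁.seeds_le h₂.seeds_le),
    (Finset.card_union_le _ _).trans (add_le_add h₁.opened_le h₂.opened_le), A₁ ∪ A₂,
    Finset.union_subset_union hA₁ hA₂, ?_, fun x hx => ?_⟩
  · rw [Finset.sum_union (Finset.disjoint_of_subset_left hA₁ (Finset.disjoint_of_subset_right hA₂ hD))]
    exact add_le_add hv₁ hv₂
  · simp only [Finset.mem_union] at hx ⊢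
    rcases hx with hx | hx
    · obtain ⟨a, b | ⟨p, hp, e⟩⟩ := hs₁ x hx
      · exact ⟨Or.inl a, Or.inl (Or.inl b)⟩
      · exact ⟨Or.inl a, Or.inr ⟨p, hp, e.imp_left Or.inl⟩⟩
    · obtain ⟨a, b | ⟨p, hp, e⟩⟩ := hs₂ x hx
      · exact ⟨Or.inr a, Or.inl (Or.inr b)⟩
      · exact ⟨Or.inr a, Or.inr ⟨p, hp, e.imp_left Or.inr⟩⟩

/-- Members that relied on x as context now find x in the active set. The new seed set S covers both
uses: the old seeds when x is supported from above, and the old seeds with x added when x is a seed.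
-/
theorem Sol.Sound.addActive [DecidableEq W] {x : V} (h : s.Sound par phys w D (some x) k l)
    (hx : x ∉ D) {S : Finset V} (hS : s.seeds ⊆ S) (hk : S.card ≤ k₁)
    (hsup : x ∈ S ∨ ∃ p, par x = some p ∧ ctx = some p) :
    Sol.Sound par phys w (insert x D) ctx k₁ (l + 1)
      ⟨w x + s.val, S, insert (phys x) s.opened⟩ := by
  obtain ⟨A, hA, hv, hs⟩ := h.active
  refine ⟨hk, (Finset.card_insert_le _ _).trans (Nat.succ_le_succ h.opened_le), insert x A,
    Finset.insert_subset_insert x hA, ?_, fun y hy => ?_⟩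
  · rw [Finset.sum_insert fun hxA => hx (hA hxA)]
    exact add_le_add le_rfl hv
  · rcases Finset.mem_insert.1 hy with rfl | hy
    · exact ⟨Finset.mem_insert_self _ _, hsup.imp_right fun ⟨p, hp, e⟩ => ⟨p, hp, Or.inr e⟩⟩
    · obtain ⟨a, b⟩ := hs y hy
      refine ⟨Finset.mem_insert_of_mem a, b.imp (fun h => hS h) ?_⟩
      rintro ⟨p, hp, hpA | e⟩
      · exact ⟨p, hp, Or.inl (Finset.mem_insert_of_mem hpA)⟩
      · cases e
        exact ⟨_, hp, Or.inl (Finset.mem_insert_self _ _)⟩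

theorem Dominated.congr (h : Dominated par w A D₁ k l c) (hD : A ∩ D₁ = A ∩ D₂) :
    Dominated par w A D₂ k l c := by
  have e : heads par A ∩ D₁ = heads par A ∩ D₂ := by
    rw [← Finset.inter_eq_left.2 (heads_subset (par := par) (A := A)), Finset.inter_assoc, hD,
      Finset.inter_assoc]
  rw [Dominated, ← e, ← hD]
  exact h

theorem Dominated.of_eq_empty (h : A ∩ D = ∅) : Dominated par w A D k l 0 := fun _ _ => by
  simp [h]

/-- The numbers of heads and members of A in each part form an admissible split of the budgets, and
each part is dominated at exactly its own numbers. -/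
theorem dominated_join {k l : ℕ} {φ₁ φ₂ : ℕ → ℕ → ℝ} (hD : Disjoint D₁ D₂)
    (h₁ : ∀ k' ≤ k, ∀ l' ≤ l, Dominated par w A D₁ k' l' (φ₁ k' l'))
    (h₂ : ∀ k' ≤ k, ∀ l' ≤ l, Dominated par w A D₂ k' l' (φ₂ k' l'))
    (hc : ∀ k₁ k₂ l₁ l₂, k₁ + k₂ ≤ k → l₁ + l₂ ≤ l → φ₁ k₁ l₁ + φ₂ k₂ l₂ ≤ c) :
    Dominated par w A (D₁ ∪ D₂) k l c := by
  intro hk hl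
  have d : ∀ B : Finset V, Disjoint (B ∩ D₁) (B ∩ D₂) := fun B =>
    Finset.disjoint_of_subset_left Finset.inter_subset_right
      (Finset.disjoint_of_subset_right Finset.inter_subset_right hD)
  rw [Finset.inter_union_distrib_left, Finset.card_union_of_disjoint (d _)] at hk hl
  rw [Finset.inter_union_distrib_left, Finset.sum_union (d _)]
  exact (add_le_add (h₁ _ (by omega) _ (by omega) le_rfl le_rfl)
    (h₂ _ (by omega) _ (by omega) le_rfl le_rfl)).trans (hc _ _ _ _ hk hl)

/-- The opening budget always drops by one. The seed budget drops only if x is a head, so the caller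
supplies that step as `hk`. -/
theorem Dominated.insert {x : V} (hx : x ∉ D) (hxA : x ∈ A)
    (h : Dominated par w A D k₁ l₁ c) (hk : (heads par A ∩ insert x D).card ≤ k →
      (heads par A ∩ D).card ≤ k₁) (hl : l ≤ l₁ + 1) :
    Dominated par w A (insert x D) k l (w x + c) := by
  intro hk' hl'
  rw [Finset.inter_insert_of_mem hxA, Finset.card_insert_of_notMem (by simp [hx])] at hl'
  rw [Finset.inter_insert_of_mem hxA, Finset.sum_insert (by simp [hx])]
  exact add_le_add le_rfl (h (hk hk') (by omega))

variable [Fintype V] {own : ℕ → Option V} {net : Net V} {depth : V → ℕ}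

/-- Activity cannot start in a subtree without heads if the owner of its top node is inactive: a
shallowest active node there has an active parent, which is either that owner or a shallower node of
the subtree. This justifies the value 0 for k = 0. -/
theorem NetInv.inter_desc_eq_empty (h : NetInv par own net)
    (hdep : ∀ p x, par x = some p → depth x = depth p + 1) {v : Node V}
    (hv : ¬ IsActive A (ownerOf own v)) (hA : heads par A ∩ net.desc v = ∅) :
    A ∩ net.desc v = ∅ := by
  by_contra hne
  obtain ⟨x, hx, hmin⟩ := (A ∩ net.desc v).exists_min_image depth
    (Finset.nonempty_iff_ne_empty.2 hne)
  obtain ⟨hxA, hxv⟩ := Finset.mem_inter.1 hx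
  have hxh : x ∉ heads par A := fun hh =>
    Finset.notMem_empty x (hA ▸ Finset.mem_inter.2 ⟨hh, hxv⟩)
  rw [mem_heads, not_and, not_not] at hxh
  obtain ⟨p, hp, e⟩ := hxh hxA
  have key : ownerOf own v = some p ∨ p ∈ net.desc v := by
    rcases Relation.ReflTransGen.cases_tail (Net.mem_desc.1 hxv) with e' | ⟨y, hvy, hyx⟩
    · exact absurd ⟨x, hxA, by rw [← e']; rfl⟩ hv
    · rw [Net.mem_desc]
      exact h.owner_reach hvy ((h.owner_eq _ _ hyx).symm.trans e)
  rcases key with ho | hd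
  · exact hv ⟨p, hp, ho⟩
  · have h1 := hmin p (Finset.mem_inter.2 ⟨hp, hd⟩)
    have h2 := hdep p x e
    omega

end Solutions

/-! ## Optimal splits -/

section Splits

variable {V W : Type} [Fintype V] [Fintype W] [DecidableEq V] [DecidableEq W]
  {par : V → Option V} {phys : V → W} {w : V → ℝ}

theorem mem_pairs {k : ℕ} {p : ℕ × ℕ} : p ∈ pairs k ↔ p.1 + p.2 ≤ k := by
  obtain ⟨a, b⟩ := p
  simp only [pairs, List.mem_filter, List.mem_product, List.mem_range, decide_eq_true_eq]
  omega

theorem length_pairs_le (k : ℕ) : (pairs k).length ≤ (k + 1) * (k + 1) := by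
  refine (List.length_filter_le _ _).trans ?_
  rw [List.length_product]
  simp

/-- Soundness holds for any admissible split that is chosen, and domination uses that the chosen one
is a maximizer. Ties are therefore harmless, and both statements serve g as well as f. -/
theorem within_bestSplit {F : Node V → ℕ → ℕ → Prog (Sol V W)} {φ : Node V → ℕ → ℕ → Sol V W}
    {us : List (Node V)} {k l : ℕ} (h0 : us ≠ []) (h2 : us.length ≤ 2) (hN : us.Nodup)
    (hF : ∀ u ∈ us, ∀ k' ≤ k, ∀ l' ≤ l, (F u k' l').Within 4 fun s => s = φ u k' l')
    {D : Node V → Finset V} {E : Finset V} (hE : ∀ x, x ∈ E ↔ ∃ u ∈ us, x ∈ D u)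
    (hD : ∀ u₁ ∈ us, ∀ u₂ ∈ us, u₁ ≠ u₂ → Disjoint (D u₁) (D u₂)) {N B : ℕ}
    (hk : k ≤ N) (hl : l ≤ N)
    (hB : 13 * (N + 1) ^ 4 + Fintype.card V + Fintype.card W + 20 ≤ B) :
    (bestSplit F us k l).Within B fun s =>
      (∀ ctx, (∀ u ∈ us, ∀ k' ≤ k, ∀ l' ≤ l, (φ u k' l').Sound par phys w (D u) ctx k' l') →
        s.Sound par phys w E ctx k l) ∧
      ∀ A, (∀ u ∈ us, ∀ k' ≤ k, ∀ l' ≤ l, Dominated par w A (D u) k' l' (φ u k' l').val) →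
        Dominated par w A E k l s.val := by
  have hM : (k + 1) ^ 2 * (l + 1) ^ 2 ≤ (N + 1) ^ 4 := by
    have := Nat.mul_le_mul (Nat.pow_le_pow_left (Nat.succ_le_succ hk) 2)
      (Nat.pow_le_pow_left (Nat.succ_le_succ hl) 2)
    rwa [← pow_add] at this
  match us with
  | [] => exact absurd rfl h0
  | [u] =>
      obtain rfl : E = D u := by ext x; simp [hE]
      have hM' : (k + 1) * (l + 1) ≤ (N + 1) ^ 4 := by
        refine le_trans ?_ hM
        exact Nat.mul_le_mul (Nat.le_self_pow (by simp) _) (Nat.le_self_pow (by simp) _)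
      have hmem : ∀ c : ℕ × ℕ, c ∈ List.range (k + 1) ×ˢ List.range (l + 1) ↔ c.1 ≤ k ∧ c.2 ≤ l := by
        rintro ⟨a, b⟩
        simp only [List.mem_product, List.mem_range]
        omega
      refine Prog.within_charge_bind (by omega) ?_
      refine Prog.Within.bind_le ((k + 1) * (l + 1) * 8 + 3) (by omega)
        (Prog.within_argmax (φ := fun c => (φ u c.1 c.2).val) (b := 5)
          (List.ne_nil_of_mem ((hmem (0, 0)).2 ⟨Nat.zero_le _, Nat.zero_le _⟩)) (fun c hc => ?_)
          (by rw [List.length_product]; simp)) ?_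
      · obtain ⟨h1, h2⟩ := (hmem c).1 hc
        refine Prog.Within.bind_le 4 (by omega) (hF u (by simp) _ h1 _ h2) ?_
        rintro _ rfl
        exact Prog.within_step rfl le_rfl
      · rintro c ⟨hc, hmax⟩
        obtain ⟨h1, h2⟩ := (hmem c).1 hc
        refine (hF u (by simp) _ h1 _ h2).mono (by omega) ?_
        rintro _ rfl
        refine ⟨fun ctx h => (h u (by simp) _ h1 _ h2).mono subset_rfl h1 h2, fun A h hk' hl' => ?_⟩
        exact (h u (by simp) _ hk' _ hl' le_rfl le_rfl).trans (hmax _ ((hmem (_, _)).2 ⟨hk', hl'⟩))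
  | [u₁, u₂] =>
      have hne : u₁ ≠ u₂ := by
        rintro rfl; simp at hN
      have hdis := hD u₁ (by simp) u₂ (by simp) hne
      obtain rfl : E = D u₁ ∪ D u₂ := by ext x; simp [hE]
      have hmem : ∀ c : (ℕ × ℕ) × (ℕ × ℕ), c ∈ pairs k ×ˢ pairs l ↔
          c.1.1 + c.1.2 ≤ k ∧ c.2.1 + c.2.2 ≤ l := by
        rintro ⟨a, b⟩
        rw [List.mem_product, mem_pairs, mem_pairs]
      have hlen : (pairs k ×ˢ pairs l).length ≤ (k + 1) ^ 2 * (l + 1) ^ 2 := by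
        rw [List.length_product, pow_two, pow_two]
        exact Nat.mul_le_mul (length_pairs_le k) (length_pairs_le l)
      refine Prog.within_charge_bind (by omega) ?_
      -- Evaluating a candidate costs 9 steps (two reads of at most 4 and the sum), and
      -- `within_argmax` adds 3. With the listing of the candidates this gives the factor 13.
      refine Prog.Within.bind_le ((k + 1) ^ 2 * (l + 1) ^ 2 * 12 + 3) (by omega)
        (Prog.within_argmax
          (φ := fun c => (φ u₁ c.1.1 c.2.1).val + (φ u₂ c.1.2 c.2.2).val) (b := 9)
          (List.ne_nil_of_mem ((hmem ((0, 0), (0, 0))).2 (by simp))) (fun c hc => ?_)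
          (by omega)) ?_
      · obtain ⟨h1, h2⟩ := (hmem c).1 hc
        refine Prog.Within.bind_le 4 (by omega) (hF u₁ (by simp) _ (by omega) _ (by omega)) ?_
        rintro _ rfl
        refine Prog.Within.bind_le 4 (by omega) (hF u₂ (by simp) _ (by omega) _ (by omega)) ?_
        rintro _ rfl
        exact Prog.within_step rfl le_rfl
      · rintro c ⟨hc, hmax⟩
        obtain ⟨h1, h2⟩ := (hmem c).1 hc
        refine Prog.Within.bind_le 4 (by omega) (hF u₁ (by simp) _ (by omega) _ (by omega)) ?_
        rintro _ rfl
        refine Prog.Within.bind_le 4 (by omega) (hF u₂ (by simp) _ (by omega) _ (by omega)) ?_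
        rintro _ rfl
        refine Prog.within_charge ⟨fun ctx h => ?_, fun A h => ?_⟩ (by omega)
        · exact ((h u₁ (by simp) _ (by omega) _ (by omega)).join
            (h u₂ (by simp) _ (by omega) _ (by omega)) hdis).mono subset_rfl h1 h2
        · exact dominated_join hdis (h u₁ (by simp)) (h u₂ (by simp))
            fun k₁ k₂ l₁ l₂ hk' hl' => hmax ((k₁, k₂), (l₁, l₂)) ((hmem _).2 ⟨hk', hl'⟩)

end Splits

/-! ## The dynamic program -/

/-- The quantity called `g`: the best stored solution in which the node is inactive or a seed. -/
noncomputable def Cell.unsupported {V W : Type} (c : Cell V W) : Sol V W :=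
  match c.actB with
  | none => c.lo
  | some b => if c.lo.val ≤ b.val then b else c.lo

theorem Cell.unsupported_spec {V W : Type} (c : Cell V W) :
    (c.unsupported = c.lo ∨ c.actB = some c.unsupported) ∧ c.lo.val ≤ c.unsupported.val ∧
      ∀ s, c.actB = some s → s.val ≤ c.unsupported.val := by
  unfold Cell.unsupported
  cases c.actB with
  | none => simp
  | some b =>
      by_cases h : c.lo.val ≤ b.val
      · simp [h]
      · simp only [h, if_false, true_or, le_refl, true_and, Option.some.injEq]
        rintro s rfl
        exact (not_le.1 h).le

section Cells

variable {V W : Type}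

theorem Table.within_read {T : Table V W} {v : Node V} {k l : ℕ} {c : Cell V W}
    (h : T v k l = some c) {B : ℕ} (hB : 2 ≤ B) : (T.read v k l).Within B fun c' => c' = c := by
  refine Prog.within_step_bind (by omega) ?_
  rw [h]
  exact Prog.within_step rfl (by omega)

theorem within_readOpt {T : Table V W} {v : Node V} {k l : ℕ} {c : Cell V W}
    (h : T v k l = some c) : (readOpt T v k l).Within 4 fun s => s = c.opt := by
  refine Prog.Within.bind_le 2 (by omega) (Table.within_read h le_rfl) ?_
  rintro _ rfl
  exact Prog.within_step rfl (by omega)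

theorem within_readUnsupported {T : Table V W} {v : Node V} {k l : ℕ} {c : Cell V W}
    (h : T v k l = some c) : (readUnsupported T v k l).Within 4 fun s => s = c.unsupported := by
  refine Prog.Within.bind_le 2 (by omega) (Table.within_read h le_rfl) ?_
  rintro c rfl
  unfold Cell.unsupported
  cases c.actB with
  | none => exact Prog.within_step rfl (by omega)
  | some b =>
      refine Prog.within_ite_test (by omega) (fun h => ?_) fun h => ?_ <;>
        exact Prog.within_step (by simp [h]) (by omega)

theorem within_computeAct {a b : Option (Sol V W)} {B : ℕ} (hB : 2 ≤ B) :
    (computeAct a b).Within B fun o => (∀ s, o = some s → a = some s ∨ b = some s) ∧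
      ∀ s, a = some s ∨ b = some s → ∃ s', o = some s' ∧ s.val ≤ s'.val := by
  cases a with
  | none =>
      cases b with
      | none => exact Prog.within_step (by simp) (by omega)
      | some b => exact Prog.within_step (by simp) (by omega)
  | some a =>
      cases b with
      | none => exact Prog.within_step (by simp) (by omega)
      | some b =>
          refine Prog.within_ite_test (by omega) (fun h => ?_) fun h => ?_
          · refine Prog.within_step ⟨by simp, ?_⟩ (by omega)
            rintro s (e | e) <;> cases e
            exacts [⟨_, rfl, le_rfl⟩, ⟨_, rfl, h⟩]
          · refine Prog.within_step ⟨by simp, ?_⟩ (by omega)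
            rintro s (e | e) <;> cases e
            exacts [⟨_, rfl, (not_le.1 h).le⟩, ⟨_, rfl, le_rfl⟩]

theorem within_computeOpt {o : Option (Sol V W)} {lo : Sol V W} {B : ℕ} (hB : 2 ≤ B) :
    (computeOpt o lo).Within B fun t => (t = lo ∨ o = some t) ∧ lo.val ≤ t.val ∧
      ∀ s, o = some s → s.val ≤ t.val := by
  cases o with
  | none => exact Prog.within_step (by simp) (by omega)
  | some a =>
      refine Prog.within_ite_test (by omega) (fun h => ?_) fun h => ?_
      · exact Prog.within_step (by simp [h]) (by omega)
      · refine Prog.within_step ⟨by simp, le_rfl, ?_⟩ (by omega)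
        rintro s e
        cases e
        exact (not_le.1 h).le

variable [Fintype V] [Fintype W]

/-- The data of a run of the dynamic program on a tree that was constructed from an instance. -/
structure Setting (P : Problem V W) (I : Input V W) (par : V → Option V) (depth : V → ℕ)
    (phys : V → W) (own : ℕ → Option V) (net : Net V) (r : Node V) : Prop where
  describes : I.Describes P
  rooted : P.Rooted par depth phys
  tree : IsTree par own net r

/-- A correctly computed cell of the table. -/
structure Cell.Correct [DecidableEq V] (I : Input V W) (par : V → Option V) (phys : V → W) (own : ℕ → Option V)
    (net : Net V) (r v : Node V) (k l : ℕ) (c : Cell V W) : Prop where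
  unsupported_sound : c.unsupported.Sound par phys I.weight (net.desc v) none k l
  -- An unseeded active top node needs a social node above it. At the root with the full seed budget
  -- this alternative is undefined, so nothing can lack support.
  opt_sound : predOf par own v ≠ none ∨ (v = r ∧ I.seedBudget ≤ k) →
    c.opt.Sound par phys I.weight (net.desc v) (predOf par own v) k l
  unsupported_max : ∀ A, ¬ IsActive A (predOf par own v) →
    Dominated par I.weight A (net.desc v) k l c.unsupported.val
  -- The strict inequalities are those under which the unseeded active alternative is defined.
  opt_max : ∀ A, IsActive A (predOf par own v) → k < I.seedBudget → l < I.openBudget →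
    Dominated par I.weight A (net.desc v) k l c.opt.val
  unsupported_le : c.unsupported.val ≤ c.opt.val

def Table.Correct [DecidableEq V] (I : Input V W) (par : V → Option V) (phys : V → W) (own : ℕ → Option V)
    (net : Net V) (r : Node V) (T : Table V W) (v : Node V) : Prop :=
  ∀ k ≤ I.seedBudget, ∀ l ≤ I.openBudget,
    ∃ c, T v k l = some c ∧ c.Correct I par phys own net r v k l

variable {P : Problem V W} {I : Input V W} {par : V → Option V} {depth : V → ℕ} {phys : V → W}
  {own : ℕ → Option V} {net : Net V} {r v : Node V} {T : Table V W} {k l S B : ℕ}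

namespace Setting

theorem seedBudget_le (h : Setting P I par depth phys own net r) :
    I.seedBudget ≤ Fintype.card V := by
  rw [h.describes.seedBudget_eq]; exact P.seedBudget_le

theorem openBudget_le (h : Setting P I par depth phys own net r) :
    I.openBudget ≤ Fintype.card V := by
  rw [h.describes.openBudget_eq, ← h.rooted.card_eq]; exact P.openBudget_le

theorem within_physOf (h : Setting P I par depth phys own net r) (x : V) (hB : 2 ≤ B) :
    (physOf I x).Within B fun y => y = phys x := by
  refine Prog.within_step_bind (by omega) ?_
  rw [h.describes.coverers_eq h.rooted x]
  exact Prog.within_step rfl (by omega)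

variable [DecidableEq V] [DecidableEq W]

/-- Splits among the outgoing neighbours, for any way of reading off solutions from cells. -/
theorem within_split (h : Setting P I par depth phys own net r)
    (hT : ∀ u ∈ net.out v, T.Correct I par phys own net r u) (h0 : net.out v ≠ [])
    (hk : k ≤ I.seedBudget) (hl : l ≤ I.openBudget)
    {F : Node V → ℕ → ℕ → Prog (Sol V W)} {ψ : Cell V W → Sol V W}
    (hF : ∀ u k l c, T u k l = some c → (F u k l).Within 4 fun s => s = ψ c)
    {E : Finset V} (hE : ∀ x, x ∈ E ↔ ∃ u ∈ net.out v, x ∈ net.desc u)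
    (hS : 13 * (Fintype.card V + 1) ^ 4 + 2 * Fintype.card V + 20 ≤ S) :
    (bestSplit F (net.out v) k l).Within S fun s =>
      (∀ ctx, (∀ u ∈ net.out v, ∀ k' ≤ k, ∀ l' ≤ l, ∀ c, c.Correct I par phys own net r u k' l' →
        (ψ c).Sound par phys I.weight (net.desc u) ctx k' l') →
        s.Sound par phys I.weight E ctx k l) ∧
      ∀ A, (∀ u ∈ net.out v, ∀ k' ≤ k, ∀ l' ≤ l, ∀ c, c.Correct I par phys own net r u k' l' →
        Dominated par I.weight A (net.desc u) k' l' (ψ c).val) →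
        Dominated par I.weight A E k l s.val := by
  have hC : ∀ u ∈ net.out v, ∀ k' ≤ k, ∀ l' ≤ l,
      ∃ c, T u k' l' = some c ∧ c.Correct I par phys own net r u k' l' :=
    fun u hu k' hk' l' hl' => hT u hu k' (hk'.trans hk) l' (hl'.trans hl)
  have hcard := h.rooted.card_eq
  refine (within_bestSplit (par := par) (phys := phys) (w := I.weight)
    -- The default solution only makes φ total; all cells within the budgets have been computed.
    (φ := fun u k l => ((T u k l).map ψ).getD ⟨0, ∅, ∅⟩) h0
    (h.tree.length_out v) (h.tree.inv.out_nodup v) (fun u hu k' hk' l' hl' => ?_) hE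
    (fun u₁ h₁ u₂ h₂ hne => h.tree.inv.desc_disjoint h.rooted.depth_eq h₁ h₂ hne)
    (hk.trans h.seedBudget_le) (hl.trans h.openBudget_le) (B := S) (by omega)).mono le_rfl ?_
  · obtain ⟨c, hc, -⟩ := hC u hu k' hk' l' hl'
    exact (hF u k' l' c hc).mono le_rfl (by simp [hc])
  · rintro s ⟨h1, h2⟩
    refine ⟨fun ctx H => h1 ctx fun u hu k' hk' l' hl' => ?_,
      fun A H => h2 A fun u hu k' hk' l' hl' => ?_⟩ <;>
    · obtain ⟨c, hc, hcc⟩ := hC u hu k' hk' l' hl'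
      simp only [hc, Option.map_some, Option.getD_some]
      exact H u hu k' hk' l' hl' c hcc

/-- With the owner of v inactive, every child has an inactive social node, or none, above it, so g
is the right quantity to split. If v is social, v itself is not in A and its subtree can be replaced
by the union of those of its children. -/
theorem within_computeLo (h : Setting P I par depth phys own net r)
    (hT : ∀ u ∈ net.out v, T.Correct I par phys own net r u)
    (hk : k ≤ I.seedBudget) (hl : l ≤ I.openBudget)
    (hS : 13 * (Fintype.card V + 1) ^ 4 + 2 * Fintype.card V + 20 ≤ S) (hB : S + 2 ≤ B) :
    (computeLo T (net.out v) k l).Within B fun s =>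
      s.Sound par phys I.weight (net.desc v) none k l ∧
      ∀ A, ¬ IsActive A (ownerOf own v) → Dominated par I.weight A (net.desc v) k l s.val := by
  have hcard := h.rooted.card_eq
  refine Prog.within_ite_test (by omega) (fun h0 => ?_) fun h0 => ?_
  · refine Prog.within_charge ⟨Sol.sound_zero, fun A hA hk' hl' => ?_⟩ (by omega)
    have e : A ∩ net.desc v = ∅ := by
      rcases h0 with rfl | rfl
      · exact h.tree.inv.inter_desc_eq_empty h.rooted.depth_eq hA
          (Finset.card_eq_zero.1 (Nat.le_zero.1 hk'))
      · exact Finset.card_eq_zero.1 (Nat.le_zero.1 hl')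
    simp [e]
  · have own_mem : ∀ A x, ¬ IsActive A (ownerOf own v) → x ∈ A → v ≠ Sum.inl x := by
      rintro A x hA hx rfl
      exact hA ⟨x, hx, rfl⟩
    refine Prog.within_ite_test (by omega) (fun hus => ?_) fun hus => ?_
    · refine Prog.within_charge ⟨Sol.sound_zero, fun A hA => Dominated.of_eq_empty ?_⟩ (by omega)
      refine Finset.eq_empty_of_forall_notMem fun x hx => ?_
      obtain ⟨hxA, hxv⟩ := Finset.mem_inter.1 hx
      rw [Net.mem_desc_iff, hus] at hxv
      simp only [List.not_mem_nil, false_and, exists_false, or_false] at hxv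
      exact own_mem A x hA hxA hxv
    · refine (h.within_split hT hus hk hl (fun u k l c hc => within_readUnsupported hc)
        (E := (net.out v).toFinset.biUnion net.desc) (by simp) hS).mono (by omega) ?_
      rintro s ⟨h1, h2⟩
      refine ⟨(h1 none fun u hu k' _ l' _ c hc => hc.unsupported_sound).mono ?_ le_rfl le_rfl,
        fun A hA => (h2 A fun u hu k' _ l' _ c hc => hc.unsupported_max A ?_).congr ?_⟩
      · intro x hx
        rw [Net.mem_desc_iff]
        exact Or.inr (by simpa using hx)
      · rwa [h.tree.inv.owner_eq v u hu]
      · ext x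
        simp only [Finset.mem_inter, Finset.mem_biUnion, List.mem_toFinset]
        rw [Net.mem_desc_iff]
        exact and_congr_right fun hx => by simp [own_mem A x hA hx]

/-- The active node x lies directly above all children, dummies included since x owns them. Hence f
is sound there with context x. -/
theorem within_below (h : Setting P I par depth phys own net r) {x : V}
    (hT : ∀ u ∈ net.out (Sum.inl x), T.Correct I par phys own net r u)
    (hk : k ≤ I.seedBudget) (hl : l ≤ I.openBudget)
    (hS : 13 * (Fintype.card V + 1) ^ 4 + 2 * Fintype.card V + 20 ≤ S) (hB : S + 1 ≤ B) :
    (below T (net.out (Sum.inl x)) k l).Within B fun s =>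
      s.Sound par phys I.weight ((net.desc (Sum.inl x)).erase x) (some x) k l ∧
      ∀ A, x ∈ A → k < I.seedBudget → l < I.openBudget →
        Dominated par I.weight A ((net.desc (Sum.inl x)).erase x) k l s.val := by
  have hcard := h.rooted.card_eq
  have hE : ∀ y, y ∈ (net.desc (Sum.inl x)).erase x ↔
      ∃ u ∈ net.out (Sum.inl x), y ∈ net.desc u := by
    intro y
    rw [Finset.mem_erase, Net.mem_desc_iff]
    constructor
    · rintro ⟨hy, e | h⟩
      · exact absurd (Sum.inl_injective e).symm hy
      · exact h
    · rintro ⟨u, hu, hy⟩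
      exact ⟨by rintro rfl; exact h.tree.inv.not_mem_desc h.rooted.depth_eq hu hy,
        Or.inr ⟨u, hu, hy⟩⟩
  refine Prog.within_ite_test (by omega) (fun hus => ?_) fun hus => ?_
  · refine Prog.within_charge ⟨Sol.sound_zero, fun A _ _ _ => Dominated.of_eq_empty ?_⟩ (by omega)
    refine Finset.eq_empty_of_forall_notMem fun y hy => ?_
    have := (hE y).1 (Finset.mem_inter.1 hy).2
    simp [hus] at this
  · refine (h.within_split hT hus hk hl (fun u k l c hc => within_readOpt hc) hE hS).mono
      (by omega) ?_
    have ho : ∀ u ∈ net.out (Sum.inl x), predOf par own u = some x := fun u hu =>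
      h.tree.inv.owner_eq _ u hu
    rintro s ⟨h1, h2⟩
    refine ⟨h1 (some x) fun u hu k' _ l' _ c hc => ?_,
      fun A hA hk0 hl0 => h2 A fun u hu k' hk' l' hl' c hc => ?_⟩
    · rw [← ho u hu]
      exact hc.opt_sound (Or.inl (by simp [ho u hu]))
    · exact hc.opt_max A ⟨x, hA, ho u hu⟩ (by omega) (by omega)

theorem insert_erase_desc {x : V} :
    insert x ((net.desc (Sum.inl x)).erase x) = net.desc (Sum.inl x) :=
  Finset.insert_erase (Net.mem_desc_iff.2 (Or.inl rfl))

/-- A supported social node costs one opening but no seed. A dummy costs nothing and passes the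
support of its owner on to its children. The conclusion k < K_s is kept because it later excludes
this alternative at the root. -/
theorem within_computeActA (h : Setting P I par depth phys own net r) (hv : v ∈ net.nodes)
    (hT : ∀ u ∈ net.out v, T.Correct I par phys own net r u)
    (hk : k ≤ I.seedBudget) (hl : l ≤ I.openBudget)
    (hS : 13 * (Fintype.card V + 1) ^ 4 + 2 * Fintype.card V + 20 ≤ S)
    (hB : S + Fintype.card V + 10 ≤ B) :
    (computeActA I T r v (net.out v) k l).Within B fun o =>
      (∀ s, o = some s → k < I.seedBudget ∧ (predOf par own v ≠ none →
        s.Sound par phys I.weight (net.desc v) (predOf par own v) k l)) ∧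
      ∀ A, IsActive A (ownerOf own v) → IsActive A (predOf par own v) → k < I.seedBudget →
        l < I.openBudget → (A ∩ net.desc v).card ≤ l →
        ∃ s, o = some s ∧ Dominated par I.weight A (net.desc v) k l s.val := by
  have hcard := h.rooted.card_eq
  cases v with
  | inl x =>
      refine Prog.within_ite_test (by omega) (fun ht => ?_) fun ht => ?_
      · refine Prog.Within.bind_le (S + 1) (by omega)
          (h.within_below hT hk (by omega) hS le_rfl) ?_
        rintro s ⟨h1, h2⟩
        refine Prog.Within.bind_le 2 (by omega) (h.within_physOf x le_rfl) ?_
        rintro _ rfl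
        refine Prog.within_charge_bind (by omega) (Prog.within_step ?_ (by omega))
        refine ⟨?_, fun A hA hpA hk0 hl0 hAl => ⟨_, rfl, ?_⟩⟩
        · rintro _ e
          cases e
          refine ⟨ht.1, fun hp => ?_⟩
          obtain ⟨p, hp⟩ := Option.ne_none_iff_exists'.1 hp
          have := h1.addActive (k₁ := k) (ctx := par x) (by simp) subset_rfl h1.seeds_le
            (Or.inr ⟨p, hp, hp⟩)
          rwa [insert_erase_desc, Nat.sub_add_cancel ht.2.1] at this
        · obtain ⟨x', hxA, e⟩ := hA
          cases e
          have hd := h2 A hxA hk0 (by omega)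
          have := Dominated.insert (k := k) (l := l) (by simp) hxA hd
            (fun hk => (Finset.card_le_card (Finset.inter_subset_inter_left
              (Finset.subset_insert _ _))).trans hk) (by omega)
          rwa [insert_erase_desc] at this
      · refine Prog.within_step ⟨by simp, fun A hA hpA hk0 hl0 hAl => ?_⟩ (by omega)
        obtain ⟨x', hxA, e⟩ := hA
        cases e
        have : 1 ≤ (A ∩ net.desc (Sum.inl x)).card := Finset.card_pos.2
          ⟨x, Finset.mem_inter.2 ⟨hxA, Net.mem_desc_iff.2 (Or.inl rfl)⟩⟩
        exact absurd ⟨hk0, this.trans hAl, hl0⟩ ht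
  | inr d =>
      have hdl := h.tree.dummy_length d ((h.tree.inv.dummy_mem d).1 hv)
      refine Prog.within_ite_test (by omega) (fun ht => ?_) fun ht => ?_
      · refine Prog.within_ite_test (by omega) (fun hl0 => ?_) fun hl0 => ?_
        · refine Prog.within_charge_bind (by omega) (Prog.within_step ?_ (by omega))
          refine ⟨?_, fun A _ _ _ _ hAl => ⟨_, rfl, Dominated.of_eq_empty ?_⟩⟩
          · rintro _ e
            cases e
            exact ⟨ht.2.1, fun _ => Sol.sound_zero⟩
          · rw [hl0] at hAl
            exact Finset.card_eq_zero.1 (Nat.le_zero.1 hAl)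
        · have ho : ∀ u ∈ net.out (Sum.inr d), predOf par own u = own d := fun u hu =>
            h.tree.inv.owner_eq _ u hu
          refine Prog.Within.bind_le S (by omega) (h.within_split hT
            (by intro e; simp [e] at hdl) hk hl
            (fun u k l c hc => within_readOpt hc) (E := net.desc (Sum.inr d))
            (fun x => by rw [Net.mem_desc_iff]; simp) hS) ?_
          rintro s ⟨h1, h2⟩
          refine Prog.within_step ⟨?_, fun A hA hpA hk0 hl0 _ => ⟨s, rfl, ?_⟩⟩ (by omega)
          · rintro _ e
            cases e
            refine ⟨ht.2.1, fun hp => h1 _ fun u hu k' _ l' _ c hc => ?_⟩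
            have e : predOf par own (Sum.inr d) = predOf par own u := (ho u hu).symm
            rw [e]
            exact hc.opt_sound (Or.inl (e ▸ hp))
          · refine h2 A fun u hu k' hk' l' hl' c hc => hc.opt_max A ?_ (by omega) (by omega)
            rw [ho u hu]
            exact hA
      · refine Prog.within_step ⟨by simp, fun A hA hpA hk0 hl0 _ => ?_⟩ (by omega)
        -- The test can only have failed because v is the root, but then there is no active social
        -- node above v.
        refine absurd ⟨?_, hk0, hl0⟩ ht
        intro e
        obtain ⟨p, -, hp⟩ := hpA
        rw [e, h.tree.root_predOf] at hp
        cases hp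

/-- An active social node whose parent is inactive is a head, so a competitor within the budgets
forces k, l ≥ 1. After paying for x, both remaining budgets lie strictly below K_s and K_p, as
maximality of f requires. -/
theorem within_computeActB (h : Setting P I par depth phys own net r)
    (hT : ∀ u ∈ net.out v, T.Correct I par phys own net r u)
    (hk : k ≤ I.seedBudget) (hl : l ≤ I.openBudget)
    (hS : 13 * (Fintype.card V + 1) ^ 4 + 2 * Fintype.card V + 20 ≤ S)
    (hB : S + 2 * Fintype.card V + 10 ≤ B) :
    (computeActB I T v (net.out v) k l).Within B fun o =>
      (∀ s, o = some s → s.Sound par phys I.weight (net.desc v) none k l) ∧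
      ∀ A, IsActive A (ownerOf own v) → ¬ IsActive A (predOf par own v) →
        (heads par A ∩ net.desc v).card ≤ k → (A ∩ net.desc v).card ≤ l →
        ∃ s, o = some s ∧ Dominated par I.weight A (net.desc v) k l s.val := by
  have hcard := h.rooted.card_eq
  cases v with
  | inl x =>
      have key : ∀ A, IsActive A (ownerOf own (Sum.inl x)) → ¬ IsActive A (par x) →
          x ∈ A ∧ x ∈ heads par A := by
        rintro A ⟨x', hxA, e⟩ hp
        cases e
        exact ⟨hxA, mem_heads.2 ⟨hxA, hp⟩⟩
      have hself : x ∈ net.desc (Sum.inl x) := Net.mem_desc_iff.2 (Or.inl rfl)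
      refine Prog.within_ite_test (by omega) (fun ht => ?_) fun ht => ?_
      · refine Prog.Within.bind_le (S + 1) (by omega)
          (h.within_below hT (by omega) (by omega) hS le_rfl) ?_
        rintro s ⟨h1, h2⟩
        refine Prog.Within.bind_le 2 (by omega) (h.within_physOf x le_rfl) ?_
        rintro _ rfl
        refine Prog.within_charge_bind (by omega) (Prog.within_charge_bind (by omega)
          (Prog.within_step ⟨?_, fun A hA hpA _ _ => ⟨_, rfl, ?_⟩⟩ (by omega)))
        · rintro _ e
          cases e
          have := h1.addActive (k₁ := k) (ctx := none) (by simp) (Finset.subset_insert x s.seeds)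
            ((Finset.card_insert_le _ _).trans (by have := h1.seeds_le; omega))
            (Or.inl (Finset.mem_insert_self _ _))
          rwa [insert_erase_desc, Nat.sub_add_cancel ht.2] at this
        · obtain ⟨hxA, hxh⟩ := key A hA hpA
          have hd := h2 A hxA (by omega) (by omega)
          have := Dominated.insert (k := k) (l := l) (by simp) hxA hd (fun hk => by
            rw [Finset.inter_insert_of_mem hxh, Finset.card_insert_of_notMem (by simp)] at hk
            omega) (by omega)
          rwa [insert_erase_desc] at this
      · refine Prog.within_step ⟨by simp, fun A hA hpA hAk hAl => ?_⟩ (by omega)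
        obtain ⟨hxA, hxh⟩ := key A hA hpA
        have h1 : 1 ≤ (heads par A ∩ net.desc (Sum.inl x)).card := Finset.card_pos.2
          ⟨x, Finset.mem_inter.2 ⟨hxh, hself⟩⟩
        have h2 : 1 ≤ (A ∩ net.desc (Sum.inl x)).card := Finset.card_pos.2
          ⟨x, Finset.mem_inter.2 ⟨hxA, hself⟩⟩
        exact absurd ⟨h1.trans hAk, h2.trans hAl⟩ ht
  -- For a dummy, owner and social node above coincide, so it cannot be active below an inactive
  -- one.
  | inr d => exact Prog.within_step ⟨by simp, fun A hA hpA => absurd hA hpA⟩ (by omega)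

/-- A competitor A is handled by the state of the owner of v. If it is inactive, the inactive
alternative dominates; if it is active, the seeded one does when nothing active lies above, and the
unseeded one otherwise. -/
theorem within_computeCell (h : Setting P I par depth phys own net r) (hv : v ∈ net.nodes)
    (hT : ∀ u ∈ net.out v, T.Correct I par phys own net r u)
    (hk : k ≤ I.seedBudget) (hl : l ≤ I.openBudget)
    (hS : 13 * (Fintype.card V + 1) ^ 4 + 2 * Fintype.card V + 20 ≤ S)
    (hB : 3 * S + 3 * Fintype.card V + 30 ≤ B) :
    (computeCell I T r v (net.out v) k l).Within B fun c =>
      c.Correct I par phys own net r v k l := by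
  refine Prog.Within.bind_le (S + 2) (by omega) (h.within_computeLo hT hk hl hS le_rfl) ?_
  rintro lo ⟨lo_sound, lo_max⟩
  refine Prog.Within.bind_le (S + Fintype.card V + 10) (by omega)
    (h.within_computeActA hv hT hk hl hS le_rfl) ?_
  rintro a ⟨a_sound, a_max⟩
  refine Prog.Within.bind_le (S + 2 * Fintype.card V + 10) (by omega)
    (h.within_computeActB hT hk hl hS le_rfl) ?_
  rintro b ⟨b_sound, b_max⟩
  refine Prog.Within.bind_le 2 (by omega) (within_computeAct le_rfl) ?_
  rintro act ⟨act_eq, act_ge⟩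
  refine Prog.Within.bind_le 2 (by omega) (within_computeOpt le_rfl) ?_
  rintro t ⟨t_eq, t_lo, t_act⟩
  refine Prog.within_step ?_ (by omega)
  set c : Cell V W := ⟨lo, a, b, act, t⟩
  obtain ⟨u_eq, u_lo, u_b⟩ := c.unsupported_spec
  have t_ge : ∀ s, a = some s ∨ b = some s → s.val ≤ t.val := fun s hs => by
    obtain ⟨s', e, hle⟩ := act_ge s hs
    exact hle.trans (t_act s' e)
  refine ⟨?_, fun hp => ?_, fun A hA hAk hAl => ?_, fun A hA hk0 hl0 hAk hAl => ?_, ?_⟩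
  · rcases u_eq with e | e
    · rw [e]; exact lo_sound
    · exact b_sound _ e
  · change t.Sound _ _ _ _ _ _ _
    rcases t_eq with e | e
    · rw [e]; exact lo_sound.weaken
    · rcases act_eq t e with e | e
      · obtain ⟨hlt, hs⟩ := a_sound t e
        -- At the root k has reached K_s, whereas an unseeded solution exists only for k < K_s.
        exact hp.elim hs fun h => absurd h.2 (not_le.2 hlt)
      · exact (b_sound t e).weaken
  · by_cases ho : IsActive A (ownerOf own v)
    · obtain ⟨s, e, hs⟩ := b_max A ho hA hAk hAl
      exact (hs hAk hAl).trans (u_b s e)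
    · exact (lo_max A ho hAk hAl).trans u_lo
  · by_cases ho : IsActive A (ownerOf own v)
    · obtain ⟨s, e, hs⟩ := a_max A ho hA hk0 hl0 hAl
      exact (hs hAk hAl).trans (t_ge s (Or.inl e))
    · exact (lo_max A ho hAk hAl).trans t_lo
  · rcases u_eq with e | e
    · rw [e]; exact t_lo
    · exact t_ge _ (Or.inr e)

/-- Here `C` bounds the cost of one cell: three splits with their overhead, the write and one step
of the loop. -/
theorem within_computeNode (h : Setting P I par depth phys own net r) (hv : v ∈ net.nodes)
    (hT : ∀ u ∈ net.out v, T.Correct I par phys own net r u) {C : ℕ}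
    (hC : 39 * (Fintype.card V + 1) ^ 4 + 9 * Fintype.card V + 92 ≤ C)
    (hB : (Fintype.card V + 1) * ((Fintype.card V + 1) * C + 2) + 2 ≤ B) :
    (computeNode I net r v T).Within B fun T' =>
      T'.Correct I par phys own net r v ∧ ∀ u ≠ v, T' u = T u := by
  have hks := h.seedBudget_le
  have hls := h.openBudget_le
  have hl1 : (I.openBudget + 1) * C ≤ (Fintype.card V + 1) * C := Nat.mul_le_mul_right _ (by omega)
  have hk1 : (I.seedBudget + 1) * ((Fintype.card V + 1) * C + 1 + 1) ≤
    (Fintype.card V + 1) * ((Fintype.card V + 1) * C + 2) := Nat.mul_le_mul_right _ (by omega)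
  refine Prog.within_step_bind (by omega) ?_
  refine (Prog.within_forList (b := (Fintype.card V + 1) * C + 1)
    (fun ks (T' : Table V W) => (∀ u ≠ v, T' u = T u) ∧ ∀ k ≤ I.seedBudget, k ∉ ks →
      ∀ l ≤ I.openBudget, ∃ c, T' v k l = some c ∧ c.Correct I par phys own net r v k l)
    ⟨fun _ _ => rfl, fun k hk hk' => absurd (List.mem_range.2 (by omega)) hk'⟩ ?_ (by
      rw [List.length_range]; omega)).mono le_rfl
        fun T' hT' => ⟨fun k hk l hl => hT'.2 k hk (by simp) l hl, hT'.1⟩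
  rintro k ks T₁ hsuf ⟨hT₁, hdone⟩
  have hk : k ≤ I.seedBudget := by
    have := List.mem_range.1 (hsuf.subset (List.mem_cons_self (a := k)))
    omega
  refine (Prog.within_forList (b := C - 1)
    (fun ls (T' : Table V W) => (∀ u ≠ v, T' u = T u) ∧
      (∀ k' ≤ I.seedBudget, k' ∉ k :: ks → ∀ l ≤ I.openBudget,
        ∃ c, T' v k' l = some c ∧ c.Correct I par phys own net r v k' l) ∧
      ∀ l ≤ I.openBudget, l ∉ ls → ∃ c, T' v k l = some c ∧ c.Correct I par phys own net r v k l)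
    ⟨hT₁, hdone, fun l hl hl' => absurd (List.mem_range.2 (by omega)) hl'⟩ ?_ (by
      rw [List.length_range, Nat.sub_add_cancel (by omega)]; omega)).mono le_rfl ?_
  · rintro l ls T₂ hsuf₂ ⟨hT₂, hd₁, hd₂⟩
    have hl : l ≤ I.openBudget := by
      have := List.mem_range.1 (hsuf₂.subset (List.mem_cons_self (a := l)))
      omega
    -- Writing cells of v leaves the tables of its children intact, since ranks exclude loops.
    have hne : ∀ u ∈ net.out v, u ≠ v := by
      rintro u hu rfl
      exact lt_irrefl _ (h.tree.inv.rank_lt h.rooted.depth_eq hu)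
    refine Prog.Within.bind_le (C - 2) (by omega) (h.within_computeCell
      (S := 13 * (Fintype.card V + 1) ^ 4 + 2 * Fintype.card V + 20) hv
      (fun u hu k hk l hl => ?_) hk hl le_rfl (by omega)) ?_
    · rw [hT₂ u (hne u hu)]
      exact hT u hu k hk l hl
    · intro c hc
      refine Prog.within_step ⟨fun u hu => ?_, fun k' hk' hkk l' hl' => ?_, fun l' hl' hll => ?_⟩
        (by omega)
      · rw [Function.update_of_ne hu]; exact hT₂ u hu
      · rw [Function.update_self, Function.update_of_ne (by rintro rfl; simp at hkk)]
        exact hd₁ k' hk' hkk l' hl'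
      · rw [Function.update_self, Function.update_self]
        by_cases e : l' = l
        · subst e
          exact ⟨c, by simp, hc⟩
        · rw [Function.update_of_ne e]
          exact hd₂ l' hl' (by simp [e, hll])
  · rintro T' ⟨h1, h2, h3⟩
    refine ⟨h1, fun k' hk' hkk => ?_⟩
    by_cases e : k' = k
    · subst e
      exact fun l hl => h3 l hl (by simp)
    · exact h2 k' hk' (by simp [e, hkk])

end Setting

end Cells

/-! ### Termination of the dynamic program, optimality of its output and total cost -/

section Main

variable {V W : Type} [Fintype V] [Fintype W]
  {P : Problem V W} {I : Input V W} {par : V → Option V} {depth : V → ℕ} {phys : V → W}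
  {own : ℕ → Option V} {net : Net V} {r v : Node V} {T : Table V W} {B : ℕ}

/-- All nodes that are marked as finished have been computed correctly. -/
def DPState.Correct [DecidableEq V] (I : Input V W) (par : V → Option V) (phys : V → W) (own : ℕ → Option V)
    (net : Net V) (r : Node V) (st : DPState V W) : Prop :=
  ∀ v, st.finished v = true → st.table.Correct I par phys own net r v

/-- A bound for the number of steps spent on one node of a network, for `n` social nodes. -/
def visitCost (n : ℕ) : ℕ :=
  (n + 1) * ((n + 1) * (39 * (n + 1) ^ 4 + 9 * n + 92) + 2) + 3

namespace Setting

/-- Take an unfinished node of greatest rank: its outgoing neighbours have greater rank and must be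
finished. -/
theorem exists_ready [DecidableEq V] (h : Setting P I par depth phys own net r) {finished : Node V → Bool}
    (hne : net.nodes.filter (fun v => !finished v) ≠ []) :
    ∃ v ∈ net.nodes.filter (fun v => !finished v), ∀ u ∈ net.out v, finished u = true := by
  obtain ⟨v, hv, hmax⟩ := (net.nodes.filter fun v => !finished v).toFinset.exists_max_image
    (rank depth own) (List.toFinset_nonempty_iff _ |>.2 hne)
  refine ⟨v, List.mem_toFinset.1 hv, fun u hu => ?_⟩
  by_contra hfu
  refine absurd (hmax u ?_) (not_le.2 (h.tree.inv.rank_lt h.rooted.depth_eq hu))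
  rw [List.mem_toFinset, List.mem_filter]
  exact ⟨(h.tree.inv.out_mem v u hu).2, by simpa using hfu⟩

variable [DecidableEq V] [DecidableEq W]

theorem within_visit (h : Setting P I par depth phys own net r) (hv : v ∈ net.nodes)
    {st : DPState V W} (hst : st.Correct I par phys own net r)
    (hf : ∀ u ∈ net.out v, st.finished u = true) (hB : visitCost (Fintype.card V) ≤ B) :
    (visit I net r v st).Within B fun st' => st'.Correct I par phys own net r ∧
      st'.finished = Function.update st.finished v true := by
  unfold visitCost at hB
  refine Prog.Within.bind_le _ ?_ (h.within_computeNode hv (fun u hu => hst u (hf u hu))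
    le_rfl le_rfl) ?_
  · omega
  · rintro T' ⟨h1, h2⟩
    refine Prog.within_step ⟨fun u hu => ?_, rfl⟩ (by omega)
    by_cases e : u = v
    · rw [e]; exact h1
    · simp only [Function.update_of_ne e] at hu
      intro k hk l hl
      simp only [h2 u e]
      exact hst u hu k hk l hl

theorem within_dpLoop (h : Setting P I par depth phys own net r) {n Z : ℕ} {st : DPState V W}
    (hst : st.Correct I par phys own net r)
    (hn : (net.nodes.filter fun v => !st.finished v).length < n) (hZ : net.nodes.length ≤ Z)
    (hB : n * (7 * Z + 5 + visitCost (Fintype.card V)) ≤ B) :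
    (dpLoop I net r n st).Within B fun st' => st'.Correct I par phys own net r ∧
      ∀ v ∈ net.nodes, st'.finished v = true := by
  induction n generalizing st B with
  | zero => omega
  | succ n ih =>
      rw [add_mul, one_mul] at hB
      refine Prog.Within.bind_le (Z * 2 + 1) (by omega)
        (Prog.within_filterList (P := fun v => !st.finished v) (b := 1)
          (fun v _ => Prog.within_step rfl le_rfl) (by omega)) ?_
      rintro todo htodo
      have hlen : todo.length ≤ Z := htodo ▸ (List.length_filter_le _ _).trans hZ
      match todo with
      | [] =>
          refine Prog.within_step ⟨hst, fun v hv => ?_⟩ (by omega)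
          have := List.filter_eq_nil_iff.1 htodo.symm v hv
          simpa using this
      | b :: bs =>
          obtain ⟨v₀, hv₀, hr₀⟩ := h.exists_ready (finished := st.finished) (by simp [← htodo])
          rw [← htodo] at hv₀
          refine Prog.Within.bind_le (Z * 4 + 1) (by omega)
            (Prog.within_filterList (P := fun v => (net.out v).all st.finished) (b := 3)
              (fun v _ => Prog.within_allList (b := 1) (fun u _ => Prog.within_step rfl le_rfl)
                (by have := h.tree.length_out v; omega)) (by omega)) ?_
          rintro ready rfl
          have hlr := List.length_filter_le (fun v => (net.out v).all st.finished) (b :: bs)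
          refine Prog.Within.bind_le (Z + 1) (by omega) (Prog.within_pickOut
            (List.ne_nil_of_mem (List.mem_filter.2 ⟨hv₀, by simpa using hr₀⟩)) (by omega)) ?_
          rintro ⟨v, rest⟩ hp
          obtain ⟨hv, hall⟩ := List.mem_filter.1 (hp.symm.subset (by simp) : v ∈ _)
          rw [htodo] at hv
          obtain ⟨hvn, hvf⟩ := List.mem_filter.1 hv
          refine Prog.Within.bind_le (visitCost (Fintype.card V)) (by omega)
            (h.within_visit hvn hst (by simpa using hall) le_rfl) ?_
          rintro st' ⟨hst', hfin⟩
          refine ih hst' ?_ (by omega)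
          have e : net.nodes.filter (fun u => !st'.finished u) =
              (net.nodes.filter fun u => !st.finished u).filter fun u => u ≠ v := by
            rw [List.filter_filter]
            refine List.filter_congr fun u _ => ?_
            rw [hfin]
            by_cases e : u = v
            · subst e; simp
            · simp [e]
          have : (net.nodes.filter fun u => !st'.finished u).length <
              (net.nodes.filter fun u => !st.finished u).length := by
            rw [e]
            exact List.length_filter_lt_length_iff_exists.2 ⟨v, hv, by simp⟩
          omega

/-- The active set of any feasible competitor fits the budgets by its heads and its size, so its
weight is at most g ≤ f at the root. The stored sets activate a set of at least that weight, and any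
further activated nodes have nonnegative weight. -/
theorem isOptimal_of_correct (h : Setting P I par depth phys own net r) {c : Cell V W}
    (hc : c.Correct I par phys own net r r I.seedBudget I.openBudget) :
    P.IsOptimal c.opt.seeds c.opt.opened := by
  have hpos : ∀ x, 0 ≤ I.weight x := fun x => by
    rw [h.describes.weight_eq]; exact (P.weight_pos x).le
  have hs := hc.opt_sound (Or.inr ⟨rfl, le_rfl⟩)
  have hm := hc.unsupported_max
  rw [h.tree.desc_root h.rooted.depth_eq, h.tree.root_predOf] at hs
  rw [h.tree.desc_root h.rooted.depth_eq, h.tree.root_predOf] at hm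
  refine ⟨⟨h.describes.seedBudget_eq ▸ hs.seeds_le, h.describes.openBudget_eq ▸ hs.opened_le⟩,
    fun S H hSH => ?_⟩
  obtain ⟨A, -, hval, hA⟩ := hs.active
  have hle : c.opt.val ≤ P.eventualWeight c.opt.seeds c.opt.opened := by
    refine hval.trans ?_
    rw [Problem.eventualWeight, ← h.describes.weight_eq]
    refine Finset.sum_le_sum_of_subset_of_nonneg (h.rooted.subset_activeAt fun x hx => ?_)
      fun x _ _ => hpos x
    refine ⟨(hA x hx).1, (hA x hx).2.imp_right ?_⟩
    rintro ⟨p, hp, hpA | e⟩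
    exacts [⟨p, hpA, hp⟩, nomatch e]
  set A' := P.activeAt S H (Fintype.card V) with hA'
  have hheads : (heads par A').card ≤ I.seedBudget := by
    refine le_trans (Finset.card_le_card fun x hx => ?_)
      (hSH.1.trans h.describes.seedBudget_eq.ge)
    obtain ⟨hxA, hxh⟩ := mem_heads.1 hx
    exact (h.rooted.supported_activeAt hxA).2.resolve_right hxh
  have hcard : A'.card ≤ I.openBudget := by
    rw [← Finset.card_image_of_injective A' h.rooted.phys_injective]
    refine le_trans (Finset.card_le_card fun y hy => ?_)
      (hSH.2.trans h.describes.openBudget_eq.ge)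
    obtain ⟨x, hx, rfl⟩ := Finset.mem_image.1 hy
    exact (h.rooted.supported_activeAt hx).1
  -- No social node lies above the root, so maximality of g applies to every active set, with no
  -- strictness of budgets required.
  have hmax := hm A' (by rintro ⟨p, -, e⟩; cases e)
  rw [Dominated, Finset.inter_univ, Finset.inter_univ] at hmax
  have := hmax hheads hcard
  rw [h.describes.weight_eq] at this
  exact (this.trans hc.unsupported_le).trans hle

theorem within_dynamicProgram (h : Setting P I par depth phys own net r) {Z : ℕ}
    (hZ : net.nodes.length ≤ Z)
    (hB : (Z + 1) * (7 * Z + 5 + visitCost (Fintype.card V)) +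
      Z * (visitCost (Fintype.card V) + 1) + 3 * Z + 10 ≤ B) :
    (dynamicProgram I net r).Within B fun out => P.IsOptimal out.1 out.2 := by
  have hl1 : (net.nodes.length + 1) * (7 * Z + 5 + visitCost (Fintype.card V)) ≤
    (Z + 1) * (7 * Z + 5 + visitCost (Fintype.card V)) := Nat.mul_le_mul_right _ (by omega)
  refine Prog.Within.bind_le (Z * 2 + 1) (by omega)
    (Prog.within_filterList (P := fun v => decide (net.out v = [])) (b := 1)
      (fun v _ => Prog.within_step rfl le_rfl) (by omega)) ?_
  rintro leaves hleaves
  have hlen : leaves.length ≤ Z := hleaves ▸ (List.length_filter_le _ _).trans hZ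
  have hl2 : leaves.length * (visitCost (Fintype.card V) + 1) ≤
    Z * (visitCost (Fintype.card V) + 1) := Nat.mul_le_mul_right _ hlen
  refine Prog.Within.bind_le (Z * (visitCost (Fintype.card V) + 1) + 1) (by omega)
    (Prog.within_forList (b := visitCost (Fintype.card V))
      (fun _ (st : DPState V W) => st.Correct I par phys own net r)
      (fun v hv => nomatch hv) ?_ (by omega)) ?_
  · intro v vs st hsuf hst
    have hv : v ∈ leaves := hsuf.subset List.mem_cons_self
    rw [hleaves, List.mem_filter, decide_eq_true_eq] at hv
    exact (h.within_visit hv.1 hst (by simp [hv.2]) le_rfl).mono le_rfl fun _ hs => hs.1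
  · intro st hst
    refine Prog.within_charge_bind (by omega) ?_
    refine Prog.Within.bind_le _ ?_ (h.within_dpLoop hst
      (Nat.lt_add_one_of_le (List.length_filter_le _ _)) hZ hl1) ?_
    · omega
    · rintro st' ⟨hst', hfin⟩
      obtain ⟨c, hc, hcc⟩ := hst' r (hfin r h.tree.root_mem) I.seedBudget le_rfl I.openBudget le_rfl
      refine Prog.Within.bind_le 2 (by omega) (Table.within_read hc le_rfl) ?_
      rintro _ rfl
      exact Prog.within_step (h.isOptimal_of_correct hcc) (by omega)

end Setting

/-- A bound for the number of nodes of the networks, for `n` social nodes. -/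
def sizeBound (n : ℕ) : ℕ := n + n * n

/-- A bound for the number of steps of the algorithm, for `n` social nodes. -/
def totalCost (n : ℕ) : ℕ :=
  (n * (n + 2) + n + 3) + (n + 1) +
  (n + 1) * (2 * (sizeBound n * sizeBound n) + 20 * sizeBound n + 10) +
  (3 * (sizeBound n * sizeBound n) + 17 * sizeBound n + 10) +
  ((2 * sizeBound n + 1 + 1) * (7 * (2 * sizeBound n + 1) + 5 + visitCost n) +
    (2 * sizeBound n + 1) * (visitCost n + 1) + 3 * (2 * sizeBound n + 1) + 10)

theorem within_forestAlgorithm [DecidableEq V] [DecidableEq W] [Nonempty V] (hI : I.Describes P)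
    (hR : P.Rooted par depth phys) :
    (forestAlgorithm I).Within (totalCost (Fintype.card V)) fun out => P.IsOptimal out.1 out.2 := by
  have hZ : Fintype.card V ≤ sizeBound (Fintype.card V) := Nat.le_add_right _ _
  refine (Prog.Within.bind (within_initialNet hI hR le_rfl) fun net hnet =>
    Prog.within_charge_bind (B := totalCost (Fintype.card V) -
      (Fintype.card V * (Fintype.card V + 2) + Fintype.card V + 3)) ?_ ?_).le ?_
  · rw [hI.length_nodes]; unfold totalCost; omega
  · rw [hI.length_nodes]
    have hbig : net.big.card ≤ Fintype.card V := Finset.card_le_univ _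
    refine Prog.Within.bind_le _ ?_
      (within_binarize hZ hnet.1 (Nat.lt_add_one_of_le hbig) ?_ le_rfl) ?_
    · unfold totalCost; omega
    · rw [hnet.2]
      exact Nat.add_le_add_left (Nat.mul_le_mul_left _ hbig) _
    · rintro net' ⟨own', hS, h2, hlen⟩
      refine Prog.Within.bind_le _ ?_ (within_joinTrees hS hR.depth_eq h2 hZ hlen le_rfl) ?_
      · unfold totalCost; omega
      · rintro ⟨r, net''⟩ ⟨own'', hT, hlen'⟩
        refine Setting.within_dynamicProgram ⟨hI, hR, hT⟩ hlen' ?_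
        unfold totalCost; omega
  · unfold totalCost; omega

end Main

/-! ## Polynomial bounds -/

/-- The function is bounded by a polynomial on the positive integers. -/
def PolyBounded (f : ℕ → ℕ) : Prop := ∃ C d : ℕ, ∀ n, 1 ≤ n → f n ≤ C * n ^ d

namespace PolyBounded

variable {f g : ℕ → ℕ}

theorem const (c : ℕ) : PolyBounded fun _ => c := ⟨c, 0, fun n _ => by simp⟩

theorem id : PolyBounded fun n => n := ⟨1, 1, fun n _ => by simp⟩

/-- Since n ≥ 1, both powers may be raised to the common exponent d + d'. -/
theorem add (hf : PolyBounded f) (hg : PolyBounded g) : PolyBounded fun n => f n + g n := by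
  obtain ⟨C, d, hf⟩ := hf
  obtain ⟨C', d', hg⟩ := hg
  refine ⟨C + C', d + d', fun n hn => ?_⟩
  rw [add_mul]
  exact add_le_add
    ((hf n hn).trans (Nat.mul_le_mul_left _ (Nat.pow_le_pow_right hn (Nat.le_add_right _ _))))
    ((hg n hn).trans (Nat.mul_le_mul_left _ (Nat.pow_le_pow_right hn (Nat.le_add_left _ _))))

theorem mul (hf : PolyBounded f) (hg : PolyBounded g) : PolyBounded fun n => f n * g n := by
  obtain ⟨C, d, hf⟩ := hf
  obtain ⟨C', d', hg⟩ := hg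
  refine ⟨C * C', d + d', fun n hn => (Nat.mul_le_mul (hf n hn) (hg n hn)).trans_eq ?_⟩
  rw [pow_add]
  ring

theorem pow (hf : PolyBounded f) (m : ℕ) : PolyBounded fun n => f n ^ m := by
  induction m with
  | zero => simpa using const 1
  | succ m ih => simpa only [pow_succ] using ih.mul hf

end PolyBounded

theorem polyBounded_sizeBound : PolyBounded sizeBound := by
  unfold sizeBound
  exact .add .id (.mul .id .id)

theorem polyBounded_visitCost : PolyBounded visitCost := by
  unfold visitCost
  have h1 : PolyBounded fun n => n + 1 := .add .id (.const 1)
  exact .add (.mul h1 (.add (.mul h1 (.add (.add (.mul (.const _) (.pow h1 4))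
    (.mul (.const _) .id)) (.const _))) (.const _))) (.const _)

theorem polyBounded_totalCost : PolyBounded totalCost := by
  unfold totalCost
  have hs := polyBounded_sizeBound
  have hv := polyBounded_visitCost
  have h1 : PolyBounded fun n => n + 1 := .add .id (.const 1)
  have h2 : PolyBounded fun n => 2 * sizeBound n + 1 := .add (.mul (.const _) hs) (.const _)
  refine .add (.add (.add (.add (.add (.add (.mul .id (.add .id (.const _))) .id) (.const _)) h1)
    (.mul h1 (.add (.add (.mul (.const _) (.mul hs hs)) (.mul (.const _) hs)) (.const _))))
    (.add (.add (.mul (.const _) (.mul hs hs)) (.mul (.const _) hs)) (.const _))) ?_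
  exact .add (.add (.add (.mul (.add h2 (.const _)) (.add (.add (.mul (.const _) h2) (.const _)) hv))
    (.mul h2 (.add hv (.const _)))) (.mul (.const _) h2)) (.const _)

end SocioPhysical

theorem mainTheorem1 :
    ∃ C d : ℕ, ∀ (V W : Type) [Fintype V] [Fintype W] [DecidableEq V] [DecidableEq W] [Nonempty V]
      (P : SocioPhysical.Problem V W) (I : SocioPhysical.Input V W),
      I.Describes P →
      P.UnitThresholds →
      P.OneToOneCover →
      SocioPhysical.IsOutForest P.graph →
      (SocioPhysical.forestAlgorithm I).Ensures fun out steps =>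
        P.IsOptimal out.1 out.2 ∧ steps ≤ C * Fintype.card V ^ d := by
  obtain ⟨C, d, hCd⟩ := SocioPhysical.polyBounded_totalCost
  refine ⟨C, d, fun V W _ _ _ _ _ P I hI hT hC hG => ?_⟩
  obtain ⟨par, depth, phys, hR⟩ := P.exists_rooted hT hC hG
  exact SocioPhysical.Prog.Ensures.mono (SocioPhysical.within_forestAlgorithm hI hR) fun _ _ h =>
    ⟨h.1, h.2.trans (hCd _ Fintype.card_pos)⟩
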